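/- Strings are finite binary strings, $|x|$ is the length of $x$, and $[x,y]=0^{|x|}1xy$ encodes the pair $(x,y)$. A programming language is a partial computable function $F$ from pairs of strings (program, input) to strings. It is optimal if for every programming language $F'$ there is a string $t$ such that $F(tp,x)=F'(p,x)$ for all strings $p,x$ (both sides undefined, or both defined and equal). For an optimal $U$ put $C(x|y)=\min\{|p| : U(p,y)=x\}$ and let $C(x)=C(x|\Lambda)$, where $\Lambda$ is the empty string. Commas denote encoded tuples, for example $C(y,z|x)=C([y,z]|x)$ and $C(p|x,y,z)=C(p|[x,[y,z]])$. Put $I(p,q:x)=C(x)-C(x|[p,q])$. Consider the network with channels $1\to2$ (carrying a string $p$) and $1\to3$ (carrying a string $q$), in which node 1 has $x,y,z$, node 2 has $x$ and needs $y$, and node 3 has $y$ and needs $z$. A pair $(p,q)$ is an $\varepsilon$ information transmission for $x,y,z$ if $C(p|x,y,z)$, $C(q|x,y,z)$, $C(y|p,x)$ and $C(z|q,y)$ are all less than $\varepsilon$. Theorem. The minimum private disclosure $I(p,q:x)$ in this network is $\max\{0,\,C(z|y)-C(y,z|x)\}$, in the following sense. (Lower bound) There are absolute constants $c,d$ and,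 for every optimal $U$, a constant $e$ depending on $U$, such that for all strings $x,y,z,p,q$ and all real $\varepsilon$ for which $(p,q)$ is an $\varepsilon$ information transmission for $x,y,z$, $$I(p,q:x)\ \ge\ \max\{0,\,C(z|y)-C(y,z|x)\}-c\,\varepsilon-d\log_2(m+2)-e,$$ where $m$ is the maximal length of $x,y,z,p,q$. (Upper bound) For every optimal $U$ there is a constant $K$ such that for every $n\ge 0$ and all strings $x,y,z$ of length at most $n$ there are strings $p,q$ of length at most $K(n+1)$ such that $(p,q)$ is a $K\log_2(n+2)$ information transmission for $x,y,z$ and $$I(p,q:x)\ \le\ \max\{0,\,C(z|y)-C(y,z|x)\}+K\log_2(n+2).$$ -/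

import Mathlib

/-! Plain Kolmogorov complexity and information transmission in the network with channels
`1 → 2` and `1 → 3`, in which node 1 has `x, y, z`, node 2 has `x` and needs `y`, and node 3 has
`y` and needs `z`. -/

namespace InfoNet

/-- Finite binary strings (`false` is the digit 0, `true` is the digit 1). -/
abbrev Str : Type := List Bool

/-- The pair `[x, y] = 0^{|x|} 1 x y`. -/
def pair (x y : Str) : Str := List.replicate x.length false ++ true :: (x ++ y)

/-- A candidate programming language: a partial map taking a program and an input to an output. -/
abbrev Lang : Type := Str → Str →. Str

/-- `U` is an optimal programming language: it is partial computable, and for every partial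
computable `F` there is a string `t` with `U (t p, x) = F (p, x)` for all `p, x`, where both sides
are undefined or both are defined and equal. -/
def IsOptimal (U : Lang) : Prop :=
  Partrec₂ U ∧ ∀ F : Lang, Partrec₂ F → ∃ t : Str, ∀ p x : Str, U (t ++ p) x = F p x

/-- Conditional Kolmogorov complexity `C(x | y)` with respect to `U`. (For optimal `U` the set is
non-empty.) -/
noncomputable def condC (U : Lang) (x y : Str) : ℕ :=
  sInf {k : ℕ | ∃ p : Str, p.length = k ∧ x ∈ U p y}

/-- Kolmogorov complexity `C(x)`. -/
noncomputable def plainC (U : Lang) (x : Str) : ℕ := condC U x []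

/-- `I(u : v) = C(v) - C(v | u)`, the information in `u` about `v`. -/
noncomputable def info (U : Lang) (u v : Str) : ℤ := (plainC U v : ℤ) - (condC U v u : ℤ)

/-- `(p, q)` is an `ε` information transmission for the input and output strings `x, y, z`:
`p` and `q` are simple given what node 1 has, and each of the nodes 2 and 3 gets what it needs. -/
def IsTransmission (U : Lang) (ε : ℝ) (x y z p q : Str) : Prop :=
  (condC U p (pair x (pair y z)) : ℝ) < ε ∧ (condC U q (pair x (pair y z)) : ℝ) < ε ∧
    (condC U y (pair p x) : ℝ) < ε ∧ (condC U z (pair q y) : ℝ) < ε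

/-- The maximal length of the strings in a list. -/
def maxLen (l : List Str) : ℕ := (l.map List.length).foldr max 0

/-- `f` is a lower bound for `g` in the network: `g ≥ f - c ε - d log n - e` for all `ε`
information transmissions, where `n` is the maximal length of `x, y, z, p, q`, where `c`, `d` are
absolute and `e` may depend on the optimal language. The functions `g = g(p, q, x, y, z)` and
`f = f(x, y, z)` may depend on the language, as complexities do. -/
def IsLowerBound (g : Lang → Str → Str → Str → Str → Str → ℤ)
    (f : Lang → Str → Str → Str → ℤ) : Prop :=
  ∃ c d : ℝ, ∀ U : Lang, IsOptimal U → ∃ e : ℝ, ∀ (x y z p q : Str) (ε : ℝ),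
    IsTransmission U ε x y z p q →
      (f U x y z : ℝ) - c * ε - d * Real.logb 2 ((maxLen [x, y, z, p, q] : ℝ) + 2) - e
        ≤ (g U p q x y z : ℝ)

/-- `f` is an upper bound for `g` in the network, with logarithmic accuracy: for all `x, y, z` of
length at most `n` there are `p, q` of length `O(n)` that are an `O(log n)` information
transmission and satisfy `g ≤ f + O(log n)`. -/
def IsLogUpperBound (g : Lang → Str → Str → Str → Str → Str → ℤ)
    (f : Lang → Str → Str → Str → ℤ) : Prop :=
  ∀ U : Lang, IsOptimal U → ∃ K : ℝ, ∀ (n : ℕ) (x y z : Str),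
    x.length ≤ n → y.length ≤ n → z.length ≤ n →
      ∃ p q : Str, (p.length : ℝ) ≤ K * ((n : ℝ) + 1) ∧ (q.length : ℝ) ≤ K * ((n : ℝ) + 1) ∧
        IsTransmission U (K * Real.logb 2 ((n : ℝ) + 2)) x y z p q ∧
        (g U p q x y z : ℝ) ≤ (f U x y z : ℝ) + K * Real.logb 2 ((n : ℝ) + 2)

/-- The minimal possible value of `g` in the network is `f`, with logarithmic accuracy. -/
def IsMinimalValue (g : Lang → Str → Str → Str → Str → Str → ℤ)
    (f : Lang → Str → Str → Str → ℤ) : Prop :=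
  IsLowerBound g f ∧ IsLogUpperBound g f

/-- The private disclosure `I(p, q : x)`. -/
noncomputable def privateDisclosure (U : Lang) (p q x _y _z : Str) : ℤ := info U (pair p q) x

end InfoNet

/-! ### Strings: decoding of pairs, binary digits, primitive recursion -/

namespace Primrec

variable {α β σ : Type*} [Primcodable α] [Primcodable β] [Primcodable σ]

/-! All estimates are up to O(log n). Lower bound: `q` with `y` gives `z`, so C(z|y) ≤ C(p,q), while
`p` and `q` are simple given `x, y, z`, so C(p,q|x) ≤ C(y,z|x) (`plainC_pair_sub_le`). By
`symmetry_of_information` the disclosure equals C(p,q) − C(p,q|x), hence is at least C(z|y) −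
C(y,z|x). It is nonnegative because a condition never raises complexity much.

Upper bound: let w = [y,z]. It suffices to find a code `p` of w relative to `x`, of length about
C(w|x), and a code `q` relative to `y`, of length about C(w|y) ≈ C(z|y), both simple given w, such
that the shorter is a prefix of the longer (`exists_codes`). Then C(p,q) ≤ max(C(w|x), C(z|y)).
Since `p` and `x` give w, C(p,q|x) ≥ C(w|x), and symmetry of information gives the bound.

The codes are the low digits of one hash value of w. Given `b`, the strings of complexity at most k
= C(w|b) are enumerated, and w is decoded as the first one whose hash has the given digits; this
works if w collides with no earlier string. A random table of polynomially many hash functions has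
the following online property: in every sequence of 2^k elements, at most 2^(k−δ) are bad, meaning
that at least a third of the functions make them collide with an earlier element
(`exists_isGoodTable`, by exponential moments and a union bound). Such a table is found by search
(`exists_computable_table`). The bad strings form a small enumerable set, so each has complexity
less than k; thus w is not bad (`exists_not_isBadStr`). For two conditions, fewer than two thirds of
the functions fail, so one function serves both (`exists_isGoodIndex`). -/

theorem nat_pow : Primrec₂ ((· ^ ·) : ℕ → ℕ → ℕ) :=
  Primrec₂.unpaired'.1 Nat.Primrec.pow

theorem list_any {f : α → List β} {p : α → β → Bool} (hf : Primrec f) (hp : Primrec₂ p) :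
    Primrec fun a => (f a).any (p a) :=
  (list_foldr hf (const false) (to₂ <| Primrec.or.comp (hp.comp fst (fst.comp snd))
    (snd.comp snd))).of_eq fun a => by induction f a <;> simp [*]

theorem list_all {f : α → List β} {p : α → β → Bool} (hf : Primrec f) (hp : Primrec₂ p) :
    Primrec fun a => (f a).all (p a) :=
  (list_foldr hf (const true) (to₂ <| Primrec.and.comp (hp.comp fst (fst.comp snd))
    (snd.comp snd))).of_eq fun a => by induction f a <;> simp [*]

theorem list_countP {f : α → List β} {p : α → β → Bool} (hf : Primrec f) (hp : Primrec₂ p) :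
    Primrec fun a => (f a).countP (p a) :=
  (list_foldr hf (const 0) (to₂ <| cond (hp.comp fst (fst.comp snd))
    (succ.comp (snd.comp snd)) (snd.comp snd))).of_eq fun a => by
      induction f a with
      | nil => rfl
      | cons b l ih =>
        simp only [List.foldr_cons, List.countP_cons, ih]
        cases p a b <;> simp

theorem list_contains [DecidableEq α] : Primrec₂ fun (l : List α) (a : α) => decide (a ∈ l) :=
  (list_any fst (Primrec.beq.comp (snd.comp fst) snd).to₂).of_eq fun p => by
    simp [List.any_eq]

end Primrec

namespace InfoNet

open Primrec

/-- The first component of a string that encodes a pair. -/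
def unpairFst (s : Str) : Str := (s.drop (s.idxOf true + 1)).take (s.idxOf true)

/-- The second component of a string that encodes a pair. -/
def unpairSnd (s : Str) : Str := (s.drop (s.idxOf true + 1)).drop (s.idxOf true)

theorem idxOf_true_pair (x y : Str) : (pair x y).idxOf true = x.length := by
  unfold pair
  rw [List.idxOf_append_of_notMem (by simp)]
  simp

theorem drop_pair (x y : Str) : (pair x y).drop (x.length + 1) = x ++ y := by
  simp [pair, List.drop_append]

@[simp] theorem unpairFst_pair (x y : Str) : unpairFst (pair x y) = x := by
  rw [unpairFst, idxOf_true_pair, drop_pair]; simp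

@[simp] theorem unpairSnd_pair (x y : Str) : unpairSnd (pair x y) = y := by
  rw [unpairSnd, idxOf_true_pair, drop_pair]; simp

@[simp] theorem length_pair (x y : Str) : (pair x y).length = 2 * x.length + 1 + y.length := by
  simp [pair]; ring

theorem pair_injective {x y x' y' : Str} (h : pair x y = pair x' y') : x = x' ∧ y = y' :=
  ⟨by simpa using congrArg unpairFst h, by simpa using congrArg unpairSnd h⟩

theorem primrec_unpairFst : Primrec unpairFst :=
  list_take.comp (list_idxOf.comp (const true) .id)
    (list_drop.comp (succ.comp (list_idxOf.comp (const true) .id)) .id)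

theorem primrec_unpairSnd : Primrec unpairSnd :=
  list_drop.comp (list_idxOf.comp (const true) .id)
    (list_drop.comp (succ.comp (list_idxOf.comp (const true) .id)) .id)

theorem primrec_pair : Primrec₂ pair :=
  (list_append.comp (list_map (list_range.comp (list_length.comp fst)) (const false).to₂)
    (list_cons.comp (const true) (list_append.comp fst snd))).of_eq fun p => by
      simp [pair]

/-- The number with the given binary digits, the least significant one first. -/
def ofBits (s : Str) : ℕ := s.foldr (fun b n => cond b (2 * n + 1) (2 * n)) 0

/-- The `l` least significant binary digits of `n`. -/
def toBits (l n : ℕ) : Str := (List.range l).map fun i => decide (n / 2 ^ i % 2 = 1)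

@[simp] theorem length_toBits (l n : ℕ) : (toBits l n).length = l := by simp [toBits]

theorem toBits_succ (l n : ℕ) : toBits (l + 1) n = decide (n % 2 = 1) :: toBits l (n / 2) := by
  simp [toBits, List.range_succ_eq_map, Function.comp_def, pow_succ', Nat.div_div_eq_div_mul]

theorem take_toBits {l l' : ℕ} (h : l ≤ l') (n : ℕ) : (toBits l' n).take l = toBits l n := by
  simp [toBits, ← List.map_take, List.take_range, h]

theorem ofBits_toBits (l n : ℕ) : ofBits (toBits l n) = n % 2 ^ l := by
  induction l generalizing n with
  | zero => simp [ofBits, toBits, Nat.mod_one]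
  | succ l ih =>
    have h : ofBits (toBits (l + 1) n)
        = cond (decide (n % 2 = 1)) (2 * ofBits (toBits l (n / 2)) + 1)
          (2 * ofBits (toBits l (n / 2))) := by
      rw [toBits_succ]; rfl
    rw [h, ih, pow_succ', Nat.mod_mul]
    rcases Nat.mod_two_eq_zero_or_one n with h | h <;> simp [h]
    ring

theorem ofBits_toBits_of_lt {l n : ℕ} (h : n < 2 ^ l) : ofBits (toBits l n) = n := by
  rw [ofBits_toBits, Nat.mod_eq_of_lt h]

theorem ofBits_lt (s : Str) : ofBits s < 2 ^ s.length := by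
  induction s with
  | nil => simp [ofBits]
  | cons b s ih =>
    have h : ofBits (b :: s) = cond b (2 * ofBits s + 1) (2 * ofBits s) := rfl
    rw [h, List.length_cons, pow_succ]
    cases b <;> (simp; omega)

/-- The position of a string in an enumeration of all strings. -/
def strIndex (s : Str) : ℕ := ofBits (s ++ [true])

theorem strIndex_lt (s : Str) : strIndex s < 2 ^ (s.length + 1) := by
  simpa [strIndex] using ofBits_lt (s ++ [true])

theorem strIndex_pos (s : Str) : 0 < strIndex s := by
  induction s with
  | nil => simp [strIndex, ofBits]
  | cons b s ih =>
    have h : strIndex (b :: s) = cond b (2 * strIndex s + 1) (2 * strIndex s) := rfl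
    cases b <;> simp [h, ih]

/-- The appended top digit 1 marks the end of the string, so trailing digits 0 are not lost. -/
theorem strIndex_injective : Function.Injective strIndex := by
  intro s
  have nil_eq : strIndex [] = 1 := rfl
  have cons_eq (b : Bool) (s : Str) :
    strIndex (b :: s) = cond b (2 * strIndex s + 1) (2 * strIndex s) := rfl
  induction s with
  | nil =>
    intro t h
    cases t with
    | nil => rfl
    | cons b t =>
      have := strIndex_pos t
      cases b <;> (simp [nil_eq, cons_eq] at h; omega)
  | cons b s ih =>
    intro t h
    have := strIndex_pos s
    cases t with
    | nil => cases b <;> simp [nil_eq, cons_eq] at h <;> omega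
    | cons b' t =>
      cases b <;> cases b' <;> simp only [cons_eq, cond_true, cond_false] at h
      · rw [ih (by omega : strIndex s = strIndex t)]
      · omega
      · omega
      · rw [ih (by omega : strIndex s = strIndex t)]

theorem primrec_ofBits : Primrec ofBits :=
  list_foldr .id (const 0) (cond (fst.comp snd) (nat_double_succ.comp (snd.comp snd))
    (nat_double.comp (snd.comp snd))).to₂

theorem primrec_strIndex : Primrec strIndex :=
  primrec_ofBits.comp (list_append.comp .id (const [true]))

theorem primrec_toBits : Primrec₂ toBits :=
  list_map (list_range.comp fst) (Primrec.eq.comp (nat_mod.comp (nat_div.comp (snd.comp fst)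
    (nat_pow.comp (const 2) snd)) (const 2)) (const 1)).decide.to₂

end InfoNet

/-! ### Basic inequalities for conditional complexity -/

namespace InfoNet

open Primrec

theorem condC_le {U : Lang} {x y p : Str} (h : x ∈ U p y) : condC U x y ≤ p.length :=
  Nat.sInf_le ⟨p, rfl, h⟩

theorem IsOptimal.exists_mem {U : Lang} (hU : IsOptimal U) (x y : Str) : ∃ p, x ∈ U p y := by
  obtain ⟨t, ht⟩ := hU.2 (fun p _ => Part.some p) (Computable.fst.partrec)
  exact ⟨t ++ x, by simp [ht]⟩

theorem IsOptimal.exists_program {U : Lang} (hU : IsOptimal U) (x y : Str) :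
    ∃ p, p.length = condC U x y ∧ x ∈ U p y := by
  have hne : {k : ℕ | ∃ p : Str, p.length = k ∧ x ∈ U p y}.Nonempty :=
    let ⟨p, hp⟩ := hU.exists_mem x y
    ⟨p.length, p, rfl, hp⟩
  exact Nat.sInf_mem hne

/-- A string computed from an input by a fixed partial computable function with a program `p` and
a numerical parameter `a < 2 ^ L` has complexity at most `p.length + 2 * L + O(1)`. -/
theorem IsOptimal.condC_le_of_partrec {U : Lang} (hU : IsOptimal U) {F : ℕ × Str × Str →. Str}
    (hF : Partrec F) :
    ∃ c, ∀ (L a : ℕ) (p y x : Str), a < 2 ^ L → x ∈ F (a, p, y) →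
      condC U x y ≤ p.length + 2 * L + c := by
  obtain ⟨t, ht⟩ := hU.2 (fun p y => F (ofBits (unpairFst p), unpairSnd p, y))
    (hF.comp (((primrec_ofBits.comp (primrec_unpairFst.comp fst)).pair
      ((primrec_unpairSnd.comp fst).pair snd)).to_comp))
  -- The parameter is the first component of a pair, hence written self-delimitingly: `2 * L + 1`
  -- digits.
  refine ⟨t.length + 1, fun L a p y x ha hx => ?_⟩
  have h : x ∈ U (t ++ pair (toBits L a) p) y := by
    rw [ht]; simpa [ofBits_toBits_of_lt ha] using hx
  have := condC_le h
  simp at this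
  omega

theorem IsOptimal.condC_map_le {U : Lang} (hU : IsOptimal U) {f : Str × Str → Str} {e : Str → Str}
    (hf : Primrec f) (he : Primrec e) :
    ∃ c, ∀ u b : Str, condC U (f (u, b)) b ≤ condC U u (e b) + c := by
  obtain ⟨t, ht⟩ := hU.2 (fun p b => (U p (e b)).map fun u => f (u, b))
    (Partrec.map (hU.1.comp Computable.fst (he.comp snd).to_comp)
      (hf.comp (snd.pair (snd.comp fst))).to_comp.to₂)
  refine ⟨t.length, fun u b => ?_⟩
  obtain ⟨p, hp, hpu⟩ := hU.exists_program u (e b)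
  have h : f (u, b) ∈ U (t ++ p) b := by
    rw [ht]; exact Part.mem_map _ hpu
  have := condC_le h
  simp at this
  omega

/-- Two programs are packed into one string, and only the one for `v` is made self-delimiting,
whence the factor 2. It is harmless when `v` is nearly determined by `g (b, u)`, as in all
applications. -/
theorem IsOptimal.condC_bind_le {U : Lang} (hU : IsOptimal U) {g : Str × Str → Str}
    {h : Str × Str × Str → Str} (hg : Primrec g) (hh : Primrec h) :
    ∃ c, ∀ b u v : Str, condC U (h (b, u, v)) b ≤ condC U u b + 2 * condC U v (g (b, u)) + c := by
  obtain ⟨t, ht⟩ := hU.2 (fun p b => (U (unpairSnd p) b).bind fun u =>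
      (U (unpairFst p) (g (b, u))).map fun v => h (b, u, v))
    (Partrec.bind (hU.1.comp (primrec_unpairSnd.comp fst).to_comp Computable.snd)
      (Partrec.map (hU.1.comp (primrec_unpairFst.comp (fst.comp fst)).to_comp
          (hg.comp ((snd.comp fst).pair snd)).to_comp)
        (hh.comp ((snd.comp (fst.comp fst)).pair ((snd.comp fst).pair snd))).to_comp.to₂))
  refine ⟨t.length + 1, fun b u v => ?_⟩
  obtain ⟨p, hp, hpu⟩ := hU.exists_program u b
  obtain ⟨r, hr, hrv⟩ := hU.exists_program v (g (b, u))
  have hm : h (b, u, v) ∈ U (t ++ pair r p) b := by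
    rw [ht]
    exact Part.mem_bind (by simpa using hpu) (Part.mem_map _ (by simpa using hrv))
  have := condC_le hm
  simp at this
  omega

theorem IsOptimal.condC_le_length {U : Lang} (hU : IsOptimal U) :
    ∃ c, ∀ x y : Str, condC U x y ≤ x.length + c := by
  obtain ⟨t, ht⟩ := hU.2 (fun p _ => Part.some p) (Computable.fst.partrec)
  refine ⟨t.length, fun x y => ?_⟩
  have := condC_le (U := U) (x := x) (y := y) (p := t ++ x) (by simp [ht])
  simp at this
  omega

end InfoNet

/-! ### Enumerations without repetitions and the complexity of enumerated strings -/

namespace InfoNet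

/-- The set of the strings that an enumeration emits. -/
def emitted (E : ℕ → Option Str) : Set Str := {v | ∃ m, E m = some v}

/-- The different strings emitted before stage `m`, the newest one first. -/
def seen (E : ℕ → Option Str) : ℕ → List Str
  | 0 => []
  | m + 1 => (E m).casesOn (seen E m) fun v =>
      if v ∈ seen E m then seen E m else v :: seen E m

theorem seen_succ (E : ℕ → Option Str) (m : ℕ) :
    seen E (m + 1) = (E m).casesOn (seen E m) fun v =>
      if v ∈ seen E m then seen E m else v :: seen E m := rfl

theorem seen_succ_of_none {E : ℕ → Option Str} {m : ℕ} (h : E m = none) :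
    seen E (m + 1) = seen E m := by rw [seen_succ, h]

theorem seen_succ_of_mem {E : ℕ → Option Str} {m : ℕ} {v : Str} (h : E m = some v)
    (hv : v ∈ seen E m) : seen E (m + 1) = seen E m := by
  rw [seen_succ, h]; exact if_pos hv

theorem seen_succ_of_notMem {E : ℕ → Option Str} {m : ℕ} {v : Str} (h : E m = some v)
    (hv : v ∉ seen E m) : seen E (m + 1) = v :: seen E m := by
  rw [seen_succ, h]; exact if_neg hv

theorem seen_nodup (E : ℕ → Option Str) (m : ℕ) : (seen E m).Nodup := by
  induction m with
  | zero => exact List.nodup_nil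
  | succ m ih =>
    rcases h : E m with _ | v
    · rwa [seen_succ_of_none h]
    · by_cases hv : v ∈ seen E m
      · rwa [seen_succ_of_mem h hv]
      · rw [seen_succ_of_notMem h hv]; exact List.nodup_cons.2 ⟨hv, ih⟩

theorem mem_seen {E : ℕ → Option Str} {m : ℕ} {v : Str} :
    v ∈ seen E m ↔ ∃ j < m, E j = some v := by
  induction m with
  | zero => simp [seen]
  | succ m ih =>
    rcases h : E m with _ | w
    · rw [seen_succ_of_none h, ih]
      refine ⟨fun ⟨j, hj, hv⟩ => ⟨j, by omega, hv⟩, fun ⟨j, hj, hv⟩ => ⟨j, ?_, hv⟩⟩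
      rcases Nat.lt_succ_iff_lt_or_eq.1 hj with h' | rfl
      · exact h'
      · simp [h] at hv
    · have key : v ∈ seen E (m + 1) ↔ v = w ∨ v ∈ seen E m := by
        by_cases hw : w ∈ seen E m
        · rw [seen_succ_of_mem h hw]
          exact ⟨Or.inr, fun h' => h'.elim (fun e => e ▸ hw) id⟩
        · rw [seen_succ_of_notMem h hw, List.mem_cons]
      rw [key, ih]
      constructor
      · rintro (rfl | ⟨j, hj, hv⟩)
        · exact ⟨m, by omega, h⟩
        · exact ⟨j, by omega, hv⟩
      · rintro ⟨j, hj, hv⟩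
        rcases Nat.lt_succ_iff_lt_or_eq.1 hj with h' | rfl
        · exact Or.inr ⟨j, h', hv⟩
        · left; rw [h] at hv; exact (Option.some.inj hv).symm

theorem seen_suffix (E : ℕ → Option Str) {m m' : ℕ} (h : m ≤ m') : seen E m <:+ seen E m' := by
  induction m', h using Nat.le_induction with
  | base => exact List.suffix_rfl
  | succ m' _ ih =>
    rcases h : E m' with _ | v
    · rwa [seen_succ_of_none h]
    · by_cases hv : v ∈ seen E m'
      · rwa [seen_succ_of_mem h hv]
      · rw [seen_succ_of_notMem h hv]; exact ih.trans (List.suffix_cons _ _)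

/-- The lists form a chain of suffixes. Hence the rank of a string in the enumeration identifies it.
-/
theorem seen_eq_of_length_eq {E : ℕ → Option Str} {m m' : ℕ}
    (h : (seen E m).length = (seen E m').length) : seen E m = seen E m' := by
  rcases le_total m m' with hm | hm
  · exact (seen_suffix E hm).eq_of_length h
  · exact ((seen_suffix E hm).eq_of_length h.symm).symm

theorem exists_seen_eq_cons {E : ℕ → Option Str} {v : Str} (h : v ∈ emitted E) :
    ∃ m, E m = some v ∧ v ∉ seen E m ∧ seen E (m + 1) = v :: seen E m := by
  classical
  have hm := Nat.find_spec h
  have hv : v ∉ seen E (Nat.find h) := fun hv => by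
    obtain ⟨j, hj, hjv⟩ := mem_seen.1 hv
    exact Nat.find_min h hj hjv
  exact ⟨Nat.find h, hm, hv, seen_succ_of_notMem hm hv⟩

theorem coe_seen_subset (E : ℕ → Option Str) (m : ℕ) :
    (↑(seen E m).toFinset : Set Str) ⊆ emitted E := fun v hv => by
  obtain ⟨j, -, hj⟩ := mem_seen.1 (by simpa using hv)
  exact ⟨j, hj⟩

theorem length_seen_le {E : ℕ → Option Str} {B : ℕ} (hB : (emitted E).encard ≤ B) (m : ℕ) :
    (seen E m).length ≤ B := by
  have h := (Set.encard_le_encard (coe_seen_subset E m)).trans hB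
  rw [Set.encard_coe_eq_coe_finsetCard, List.toFinset_card_of_nodup (seen_nodup E m)] at h
  exact_mod_cast h

theorem exists_subset_seen {E : ℕ → Option Str} (F : Finset Str) (hF : ↑F ⊆ emitted E) :
    ∃ m, ∀ v ∈ F, v ∈ seen E m := by
  have h : ∀ v : F, ∃ j, E j = some v.1 := fun v => hF v.2
  choose j hj using h
  refine ⟨F.attach.sup j + 1, fun v hv => mem_seen.2 ⟨j ⟨v, hv⟩, ?_, hj _⟩⟩
  exact Nat.lt_succ_of_le (Finset.le_sup (f := j) (Finset.mem_attach F ⟨v, hv⟩))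

theorem computable_seen {α : Type*} [Primcodable α] {E : α → ℕ → Option Str}
    (hE : Computable₂ E) : Computable₂ fun a m => seen (E a) m := by
  have hite : Primrec₂ fun (s : List Str × Option Str) (v : Str) =>
      if v ∈ s.1 then s.1 else v :: s.1 := by
    have hmem : PrimrecPred fun q : (List Str × Option Str) × Str => q.2 ∈ q.1.1 :=
      Primrec.primrecPred
        ((Primrec.list_contains.comp (Primrec.fst.comp Primrec.fst) Primrec.snd).of_eq
          fun _ => decide_eq_decide.2 Iff.rfl)
    exact Primrec.ite hmem (Primrec.fst.comp Primrec.fst)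
      (Primrec.list_cons.comp Primrec.snd (Primrec.fst.comp Primrec.fst))
  have hstep : Primrec fun s : List Str × Option Str =>
      (s.2.casesOn s.1 fun v => if v ∈ s.1 then s.1 else v :: s.1 : List Str) :=
    Primrec.option_casesOn Primrec.snd Primrec.fst hite
  refine (Computable.nat_rec (f := fun p : α × ℕ => p.2) (g := fun _ => ([] : List Str))
    (h := fun p q => (q.2, E p.1 q.1).2.casesOn q.2 fun v => if v ∈ q.2 then q.2 else v :: q.2)
    Computable.snd (Computable.const _) (hstep.to_comp.comp ((Computable.snd.comp
      Computable.snd).pair (hE.comp (Computable.fst.comp Computable.fst)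
        (Computable.fst.comp Computable.snd)))).to₂).of_eq fun p => ?_
  obtain ⟨a, m⟩ := p
  induction m with
  | zero => rfl
  | succ m ih => simp only at ih ⊢; rw [ih]; rfl

/-- The head of a list of length `r + 1`. -/
def headOfLength (s : List Str × ℕ) : Option Str :=
  if s.1.length = s.2 + 1 then s.1.head? else none

theorem primrec_headOfLength : Primrec headOfLength :=
  Primrec.ite (Primrec.eq.comp (Primrec.list_length.comp Primrec.fst)
    (Primrec.succ.comp Primrec.snd)) (Primrec.list_head?.comp Primrec.fst) (Primrec.const _)

/-- Whatever stage the search stops at, a list of the required length is the same list, so its head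
is `v`. -/
theorem mem_rfindOpt_headOfLength {E : ℕ → Option Str} {v : Str} {m : ℕ}
    (hm : seen E (m + 1) = v :: seen E m) :
    v ∈ Nat.rfindOpt fun m' => headOfLength (seen E m', (seen E m).length) := by
  have hdom : (Nat.rfindOpt fun m' => headOfLength (seen E m', (seen E m).length)).Dom := by
    rw [Nat.rfindOpt_dom]
    exact ⟨m + 1, v, by simp [hm, headOfLength]⟩
  obtain ⟨w, hw⟩ := Part.dom_iff_mem.1 hdom
  obtain ⟨m', hm'⟩ := Nat.rfindOpt_spec hw
  unfold headOfLength at hm'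
  split_ifs at hm' with h
  · have heq : seen E m' = seen E (m + 1) :=
      seen_eq_of_length_eq (by rw [h, hm, List.length_cons])
    simp only [heq, hm] at hm'
    have : v = w := by simpa using hm'
    exact this ▸ hw
  · simp at hm'

/-- If a uniformly enumerable set has at most `2 ^ l` elements, then each of them has complexity
at most `l`, up to the size of the parameter. -/
theorem IsOptimal.condC_le_of_mem_emitted {U : Lang} (hU : IsOptimal U)
    {E : ℕ × Str → ℕ → Option Str} (hE : Computable₂ E) :
    ∃ c, ∀ (L a l : ℕ) (b v : Str), a < 2 ^ L → v ∈ emitted (E (a, b)) →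
      (emitted (E (a, b))).encard ≤ (2 ^ l : ℕ) → condC U v b ≤ l + 2 * L + c := by
  have hg : Computable₂ fun (s : ℕ × Str × Str) (m : ℕ) =>
      headOfLength (seen (E (s.1, s.2.2)) m, ofBits s.2.1) := by
    have h₂ : Computable fun s : (ℕ × Str × Str) × ℕ => seen (E (s.1.1, s.1.2.2)) s.2 :=
      (computable_seen hE).comp
        (Primrec.to_comp ((Primrec.fst.comp Primrec.fst).pair
          (Primrec.snd.comp (Primrec.snd.comp Primrec.fst)))) Computable.snd
    have h₃ : Primrec fun s : (ℕ × Str × Str) × ℕ => ofBits s.1.2.1 :=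
      primrec_ofBits.comp (Primrec.fst.comp (Primrec.snd.comp Primrec.fst))
    exact primrec_headOfLength.to_comp.comp (h₂.pair h₃.to_comp)
  obtain ⟨c, hc⟩ := hU.condC_le_of_partrec (Partrec.rfindOpt hg)
  refine ⟨c, fun L a l b v ha hv hcard => ?_⟩
  obtain ⟨m, -, -, hm⟩ := exists_seen_eq_cons hv
  have hlen := length_seen_le hcard (m + 1)
  rw [hm, List.length_cons] at hlen
  -- Fewer than `2 ^ l` strings precede `v`, so its rank fits into `l` digits; these are the
  -- program.
  have hr : ofBits (toBits l (seen (E (a, b)) m).length) = (seen (E (a, b)) m).length :=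
    ofBits_toBits_of_lt hlen
  have := hc L a (toBits l (seen (E (a, b)) m).length) b v ha
    (by dsimp only; rw [hr]; exact mem_rfindOpt_headOfLength hm)
  rwa [length_toBits] at this

/-! ### The enumeration of the strings of bounded complexity -/

/-- Running a code for `U` with a step bound is primitive recursive, which makes strings of bounded
complexity uniformly enumerable. -/
theorem exists_primrec_stage {U : Lang} (hU : Partrec₂ U) :
    ∃ S : ℕ × Str × Str → Option Str, Primrec S ∧
      ∀ p b v : Str, v ∈ U p b ↔ ∃ t, S (t, p, b) = some v := by
  obtain ⟨c, hc⟩ := Nat.Partrec.Code.exists_code.1 hU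
  refine ⟨fun s => (Nat.Partrec.Code.evaln s.1 c (Encodable.encode s.2)).bind Encodable.decode,
    ?_, fun p b v => ?_⟩
  · exact Primrec.option_bind (Nat.Partrec.Code.primrec_evaln.comp
      ((Primrec.fst.pair (Primrec.const c)).pair (Primrec.encode.comp Primrec.snd)))
      (Primrec.decode.comp Primrec.snd).to₂
  · have he : c.eval (Encodable.encode (p, b)) = (U p b).map Encodable.encode := by
      rw [hc]; simp
    constructor
    · intro hv
      have : Encodable.encode v ∈ c.eval (Encodable.encode (p, b)) := by
        rw [he]; exact Part.mem_map _ hv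
      obtain ⟨t, ht⟩ := Nat.Partrec.Code.evaln_complete.1 this
      refine ⟨t, ?_⟩
      dsimp only
      rw [Option.mem_def.1 ht, Option.bind_some, Encodable.encodek]
    · rintro ⟨t, ht⟩
      obtain ⟨n, hn, hnv⟩ := Option.bind_eq_some_iff.1 ht
      have := Nat.Partrec.Code.evaln_sound hn
      rw [he] at this
      obtain ⟨w, hw, rfl⟩ := (Part.mem_map_iff _).1 this
      simp at hnv
      exact hnv ▸ hw

/-- The enumeration of the outputs on input `b` of the programs of length at most `k`, given
the stages of the programming language. -/
def boundedEnum (S : ℕ × Str × Str → Option Str) (a : ℕ × Str) (m : ℕ) : Option Str :=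
  (Encodable.decode m.unpair.2 : Option Str).bind fun p =>
    if p.length ≤ a.1 then S (m.unpair.1, p, a.2) else none

theorem primrec_boundedEnum {S : ℕ × Str × Str → Option Str} (hS : Primrec S) :
    Primrec₂ (boundedEnum S) := by
  have hm : Primrec fun s : ((ℕ × Str) × ℕ) × Str => s.1.2.unpair.1 :=
    Primrec.fst.comp (Primrec.unpair.comp (Primrec.snd.comp Primrec.fst))
  exact Primrec.option_bind
    (Primrec.decode.comp (Primrec.snd.comp (Primrec.unpair.comp Primrec.snd)))
    (Primrec.ite (Primrec.nat_le.comp (Primrec.list_length.comp Primrec.snd)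
        (Primrec.fst.comp (Primrec.fst.comp Primrec.fst)))
      (hS.comp (hm.pair (Primrec.snd.pair (Primrec.snd.comp (Primrec.fst.comp Primrec.fst)))))
      (Primrec.const _)).to₂

theorem IsOptimal.emitted_boundedEnum {U : Lang} (hU : IsOptimal U)
    {S : ℕ × Str × Str → Option Str}
    (hS : ∀ p b v : Str, v ∈ U p b ↔ ∃ t, S (t, p, b) = some v) (k : ℕ) (b : Str) :
    emitted (boundedEnum S (k, b)) = {v | condC U v b ≤ k} := by
  ext v
  constructor
  · rintro ⟨m, hm⟩
    obtain ⟨p, -, hp⟩ := Option.bind_eq_some_iff.1 hm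
    split_ifs at hp with h
    exact (condC_le ((hS _ _ _).2 ⟨_, hp⟩)).trans h
  · intro hv
    obtain ⟨p, hp, hpv⟩ := hU.exists_program v b
    obtain ⟨t, ht⟩ := (hS _ _ _).1 hpv
    refine ⟨Nat.pair t (Encodable.encode p), ?_⟩
    have : p.length ≤ k := hp ▸ hv
    simp [boundedEnum, this, ht]

/-- Different strings have different shortest programs, and those have length at most `k`. -/
theorem IsOptimal.encard_condC_le {U : Lang} (hU : IsOptimal U) (k : ℕ) (b : Str) :
    {v | condC U v b ≤ k}.encard ≤ (2 ^ (k + 1) : ℕ) := by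
  choose prog hlen hprog using fun v => hU.exists_program v b
  have h : Set.InjOn (fun v => strIndex (prog v)) {v | condC U v b ≤ k} := fun v _ w _ hvw => by
    have := strIndex_injective hvw
    exact Part.mem_unique (hprog v) (this ▸ hprog w)
  rw [← h.encard_image]
  have hsub : (fun v => strIndex (prog v)) '' {v | condC U v b ≤ k} ⊆
      ↑(Finset.range (2 ^ (k + 1))) := by
    rintro _ ⟨v, hv, rfl⟩
    have h₁ := strIndex_lt (prog v)
    have h₂ : 2 ^ ((prog v).length + 1) ≤ 2 ^ (k + 1) :=
      Nat.pow_le_pow_right (by norm_num) (by rw [hlen]; exact Nat.succ_le_succ hv)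
    simpa using h₁.trans_le h₂
  refine (Set.encard_le_encard hsub).trans ?_
  rw [Set.encard_coe_eq_coe_finsetCard, Finset.card_range]

end InfoNet

/-! ### Symmetry of information -/

namespace InfoNet

/-- Shortest programs for `x` and for `u` given `x` are concatenated; the numerical parameter tells
where to cut. -/
theorem IsOptimal.plainC_pair_le {U : Lang} (hU : IsOptimal U) :
    ∃ c, ∀ (L : ℕ) (u x : Str), plainC U x < 2 ^ L →
      plainC U (pair u x) ≤ plainC U x + condC U u x + 2 * L + c := by
  have hF : Partrec fun s : ℕ × Str × Str => (U (s.2.1.take s.1) []).bind fun x =>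
      (U (s.2.1.drop s.1) x).map fun u => pair u x := by
    refine Partrec.bind (hU.1.comp (Primrec.list_take.comp Primrec.fst
      (Primrec.fst.comp Primrec.snd)).to_comp (Computable.const _)) ?_
    exact Partrec.map (hU.1.comp (Primrec.list_drop.comp (Primrec.fst.comp Primrec.fst)
      (Primrec.fst.comp (Primrec.snd.comp Primrec.fst))).to_comp Computable.snd)
      (primrec_pair.comp Primrec.snd (Primrec.snd.comp Primrec.fst)).to_comp.to₂
  obtain ⟨c, hc⟩ := hU.condC_le_of_partrec hF
  refine ⟨c, fun L u x hL => ?_⟩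
  obtain ⟨p, hp, hpx⟩ := hU.exists_program x []
  obtain ⟨r, hr, hru⟩ := hU.exists_program u x
  have := hc L p.length (p ++ r) [] (pair u x) (by rw [hp]; exact hL)
    (by
      rw [List.take_left, List.drop_left]
      exact Part.mem_bind hpx (Part.mem_map _ hru))
  rw [List.length_append, hp, hr] at this
  exact this

/-- The enumeration of the second components of the enumerated pairs with first component `u`. -/
def sectionEnum (E : ℕ → Option Str) (u : Str) (m : ℕ) : Option Str :=
  (E m).bind fun s => if pair u (unpairSnd s) = s then some (unpairSnd s) else none

theorem emitted_sectionEnum (E : ℕ → Option Str) (u : Str) :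
    emitted (sectionEnum E u) = {x | pair u x ∈ emitted E} := by
  ext x
  constructor
  · rintro ⟨m, hm⟩
    obtain ⟨s, hs, hsx⟩ := Option.bind_eq_some_iff.1 hm
    split_ifs at hsx with h
    refine ⟨m, ?_⟩
    rw [hs, ← Option.some.inj hsx, h]
  · rintro ⟨m, hm⟩
    exact ⟨m, by simp [sectionEnum, hm]⟩

theorem primrec_sectionEnum {S : ℕ × Str × Str → Option Str} (hS : Primrec S) :
    Primrec₂ fun (a : ℕ × Str) (m : ℕ) => sectionEnum (boundedEnum S (a.1, [])) a.2 m := by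
  have hu : Primrec fun q : ((ℕ × Str) × ℕ) × Str => q.1.1.2 :=
    Primrec.snd.comp (Primrec.fst.comp Primrec.fst)
  have hs : Primrec fun q : ((ℕ × Str) × ℕ) × Str => unpairSnd q.2 :=
    primrec_unpairSnd.comp Primrec.snd
  exact Primrec.option_bind ((primrec_boundedEnum hS).comp
      ((Primrec.fst.comp Primrec.fst).pair (Primrec.const _)) Primrec.snd)
    (Primrec.ite (Primrec.eq.comp (primrec_pair.comp hu hs) Primrec.snd)
      (Primrec.option_some.comp hs) (Primrec.const _)).to₂

/-- The string with code `m.unpair.2` if it is the first component of at least `2 ^ l` pairs in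
the list, for a triple of the list, `l` and `m`. -/
def heavyStep (t : List Str × ℕ × ℕ) : Option Str :=
  (Encodable.decode t.2.2.unpair.2 : Option Str).bind fun u =>
    if 2 ^ t.2.1 ≤ t.1.countP (fun s => decide (pair u (unpairSnd s) = s))
    then some u else none

theorem primrec_heavyStep : Primrec heavyStep := by
  have hcount : Primrec fun q : (List Str × ℕ × ℕ) × Str =>
      q.1.1.countP fun s => decide (pair q.2 (unpairSnd s) = s) :=
    Primrec.list_countP (Primrec.fst.comp Primrec.fst)
      (Primrec.eq.comp (primrec_pair.comp (Primrec.snd.comp Primrec.fst)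
        (primrec_unpairSnd.comp Primrec.snd)) Primrec.snd).decide.to₂
  have hpow : Primrec fun q : (List Str × ℕ × ℕ) × Str => 2 ^ q.1.2.1 :=
    Primrec.nat_pow.comp (Primrec.const 2) (Primrec.fst.comp (Primrec.snd.comp Primrec.fst))
  have hite : Primrec₂ fun (t : List Str × ℕ × ℕ) (u : Str) =>
      if 2 ^ t.2.1 ≤ t.1.countP (fun s => decide (pair u (unpairSnd s) = s))
      then some u else none :=
    Primrec.ite (Primrec.nat_le.comp hpow hcount)
      (Primrec.option_some.comp Primrec.snd) (Primrec.const _)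
  exact Primrec.option_bind (Primrec.decode.comp (Primrec.snd.comp (Primrec.unpair.comp
      (Primrec.snd.comp Primrec.snd)))) hite

/-- The enumeration of the strings that are the first component of at least `2 ^ l` enumerated
pairs. -/
def heavyEnum (E : ℕ → Option Str) (l m : ℕ) : Option Str :=
  heavyStep (seen E m.unpair.1, l, m)

theorem computable_heavyEnum {S : ℕ × Str × Str → Option Str} (hS : Primrec S) :
    Computable₂ fun (a : ℕ × Str) (m : ℕ) =>
      heavyEnum (boundedEnum S (a.1.unpair.1, [])) a.1.unpair.2 m := by
  have hE : Computable₂ fun (a : ℕ × Str) (m : ℕ) => boundedEnum S (a.1.unpair.1, []) m :=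
    ((primrec_boundedEnum hS).comp ((Primrec.fst.comp (Primrec.unpair.comp
      (Primrec.fst.comp Primrec.fst))).pair (Primrec.const _)) Primrec.snd).to_comp
  have h₂ : Computable fun q : (ℕ × Str) × ℕ =>
      seen (boundedEnum S (q.1.1.unpair.1, [])) q.2.unpair.1 :=
    (computable_seen hE).comp Computable.fst
      (Primrec.fst.comp (Primrec.unpair.comp Primrec.snd)).to_comp
  exact primrec_heavyStep.to_comp.comp (h₂.pair ((Primrec.snd.comp (Primrec.unpair.comp
    (Primrec.fst.comp Primrec.fst))).pair Primrec.snd).to_comp)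

theorem mem_emitted_heavyEnum {E : ℕ → Option Str} {l : ℕ} {u : Str} (F : Finset Str)
    (hF : ∀ x ∈ F, pair u x ∈ emitted E) (hl : 2 ^ l ≤ F.card) :
    u ∈ emitted (heavyEnum E l) := by
  obtain ⟨t, ht⟩ := exists_subset_seen (E := E) (F.image (pair u)) (by
    intro s hs
    obtain ⟨x, hx, rfl⟩ := Finset.mem_image.1 (Finset.mem_coe.1 hs)
    exact hF x hx)
  refine ⟨Nat.pair t (Encodable.encode u), ?_⟩
  have hsub : F.image (pair u) ⊆
      ((seen E t).filter fun s => decide (pair u (unpairSnd s) = s)).toFinset := by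
    intro s hs
    have := ht s hs
    obtain ⟨x, hx, rfl⟩ := Finset.mem_image.1 hs
    simp [this]
  have hcard := Finset.card_le_card hsub
  rw [Finset.card_image_of_injective _ fun x y h => (pair_injective h).2,
    List.toFinset_card_of_nodup ((seen_nodup E t).filter _), ← List.countP_eq_length_filter]
    at hcard
  have := hl.trans hcard
  simp only [heavyEnum, heavyStep, Nat.unpair_pair, Encodable.encodek, Option.bind_some]
  exact if_pos this

/-- Heavy strings own disjoint sets of at least `2 ^ l` pairs each, out of at most `2 ^ k`. -/
theorem encard_emitted_heavyEnum {E : ℕ → Option Str} {k l : ℕ} (hlk : l ≤ k)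
    (hE : (emitted E).encard ≤ (2 ^ k : ℕ)) :
    (emitted (heavyEnum E l)).encard ≤ (2 ^ (k - l) : ℕ) := by
  have hfin : (emitted E).Finite :=
    Set.finite_of_encard_le_coe hE
  have key : ∀ F : Finset Str, ↑F ⊆ emitted (heavyEnum E l) → F.card ≤ 2 ^ (k - l) := by
    intro F hF
    have hP : hfin.toFinset.card ≤ 2 ^ k := by
      rw [hfin.encard_eq_coe_toFinset_card] at hE
      exact_mod_cast hE
    have h₁ : ∀ u ∈ F, 2 ^ l ≤
        (hfin.toFinset.filter fun s => pair u (unpairSnd s) = s).card := by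
      intro u hu
      obtain ⟨m, hm⟩ := hF hu
      obtain ⟨u', -, hu'⟩ := Option.bind_eq_some_iff.1 hm
      split_ifs at hu' with h
      obtain rfl := Option.some.inj hu'
      refine h.trans ?_
      rw [List.countP_eq_length_filter,
        ← List.toFinset_card_of_nodup ((seen_nodup E _).filter _)]
      refine Finset.card_le_card fun s hs => ?_
      have hs' := List.mem_filter.1 (List.mem_toFinset.1 hs)
      obtain ⟨j, -, hj⟩ := mem_seen.1 hs'.1
      exact Finset.mem_filter.2 ⟨hfin.mem_toFinset.2 ⟨j, hj⟩, by simpa using hs'.2⟩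
    have h₂ : ∑ u ∈ F, (hfin.toFinset.filter fun s => pair u (unpairSnd s) = s).card
        ≤ hfin.toFinset.card := by
      rw [← Finset.card_biUnion]
      · exact Finset.card_le_card (Finset.biUnion_subset.2 fun u _ => Finset.filter_subset _ _)
      · intro u _ u' _ hne
        refine Finset.disjoint_left.2 fun s hs hs' => hne ?_
        have e := (Finset.mem_filter.1 hs).2.trans (Finset.mem_filter.1 hs').2.symm
        exact (pair_injective e).1
    have h₃ : F.card * 2 ^ l ≤ 2 ^ k := by
      refine le_trans ?_ (h₂.trans hP)
      rw [← smul_eq_mul]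
      exact Finset.card_nsmul_le_sum _ _ _ h₁
    have h₄ : 2 ^ k = 2 ^ (k - l) * 2 ^ l := by rw [← pow_add, Nat.sub_add_cancel hlk]
    rw [h₄] at h₃
    exact Nat.le_of_mul_le_mul_right h₃ (by positivity)
  -- The count applies to finite sets only; an excess, possibly infinite, is reduced to a subset
  -- with exactly one element too many.
  by_contra hlt
  rw [not_le] at hlt
  obtain ⟨T, hT, hTc⟩ := Set.exists_subset_encard_eq (Order.add_one_le_of_lt hlt)
  have hTf : T.Finite := Set.finite_of_encard_le_coe (k := 2 ^ (k - l) + 1) (by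
    rw [hTc]; push_cast; exact le_rfl)
  have := key hTf.toFinset (by simpa using hT)
  rw [hTf.encard_eq_coe_toFinset_card] at hTc
  have h' : hTf.toFinset.card = 2 ^ (k - l) + 1 := by exact_mod_cast hTc
  omega

/-- **Symmetry of information** (Kolmogorov and Levin). -/
theorem IsOptimal.symmetry_of_information {U : Lang} (hU : IsOptimal U) :
    ∃ c, ∀ (L : ℕ) (u x : Str), 2 * u.length + x.length + c ≤ 2 ^ L →
      plainC U u + condC U x u ≤ plainC U x + condC U u x + 8 * L + c := by
  obtain ⟨S, hS, hSU⟩ := exists_primrec_stage hU.1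
  obtain ⟨c₁, hc₁⟩ := hU.plainC_pair_le
  obtain ⟨c₂, hc₂⟩ := hU.condC_le_of_mem_emitted (primrec_sectionEnum hS).to_comp
  obtain ⟨c₃, hc₃⟩ := hU.condC_le_of_mem_emitted (computable_heavyEnum hS)
  obtain ⟨c₄, hc₄⟩ := hU.condC_le_length
  refine ⟨c₁ + c₂ + c₃ + c₄ + 4, fun L u x hL => ?_⟩
  have hx := hc₄ x []
  have hux := hc₄ (pair u x) []
  rw [length_pair] at hux
  have h₁ := hc₁ L u x (show condC U x [] < 2 ^ L by omega)
  unfold plainC at h₁ ⊢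
  set k := condC U (pair u x) [] with hk
  have hE : emitted (boundedEnum S (k, [])) = {v | condC U v [] ≤ k} :=
    hU.emitted_boundedEnum hSU k []
  have hcard := hU.encard_condC_le k []
  have hfin : {y | pair u y ∈ emitted (boundedEnum S (k, []))}.Finite := by
    rw [hE]
    exact (Set.finite_of_encard_le_coe hcard).preimage
      (fun y _ z _ h => (pair_injective h).2)
  have hxmem : x ∈ hfin.toFinset := hfin.mem_toFinset.2 (by
    change pair u x ∈ emitted _
    rw [hE]; exact hk.ge)
  have hpos : hfin.toFinset.card ≠ 0 := (Finset.card_pos.2 ⟨x, hxmem⟩).ne'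
  -- About `2 ^ l` strings `y` satisfy C(u,y) ≤ `k`. Given `u`, the string `x` is one of them, which
  -- costs about `l`; and `u` is one of about `2 ^ (k - l)` heavy strings. In the sum `l` cancels.
  set l := Nat.log 2 hfin.toFinset.card with hl
  have hl₁ : 2 ^ l ≤ hfin.toFinset.card := Nat.pow_log_le_self 2 hpos
  have hl₂ : hfin.toFinset.card ≤ 2 ^ (l + 1) := (Nat.lt_pow_succ_log_self (by norm_num) _).le
  have hle : hfin.toFinset.card ≤ 2 ^ (k + 1) := by
    have h : ((hfin.toFinset.image (pair u) : Finset Str) : Set Str).encard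
        ≤ (2 ^ (k + 1) : ℕ) := by
      refine (Set.encard_le_encard ?_).trans hcard
      intro s hs
      obtain ⟨y, hy, rfl⟩ := Finset.mem_image.1 (Finset.mem_coe.1 hs)
      have := hfin.mem_toFinset.1 hy
      rwa [hE] at this
    rw [Set.encard_coe_eq_coe_finsetCard, Finset.card_image_of_injective _
      fun y z h => (pair_injective h).2] at h
    exact_mod_cast h
  have hlk : l ≤ k + 1 :=
    (Nat.pow_le_pow_iff_right (by norm_num : 1 < 2)).1 (hl₁.trans hle)
  have hkL : k < 2 ^ L := by omega
  have h₂ : condC U x u ≤ (l + 1) + 2 * L + c₂ := by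
    refine hc₂ L k (l + 1) u x hkL ?_ ?_
    · rw [emitted_sectionEnum]
      exact hfin.mem_toFinset.1 hxmem
    · rw [emitted_sectionEnum]
      dsimp only
      rw [hfin.encard_eq_coe_toFinset_card]
      exact_mod_cast hl₂
  have h₃ : condC U u [] ≤ (k + 1 - l) + 2 * (2 * L) + c₃ := by
    have ha : Nat.pair k l < 2 ^ (2 * L) := by
      refine (Nat.pair_lt_max_add_one_sq k l).trans_le ?_
      rw [mul_comm 2 L, pow_mul]
      exact Nat.pow_le_pow_left (by omega) 2
    refine hc₃ (2 * L) (Nat.pair k l) (k + 1 - l) [] u ha ?_ ?_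
    · simp only [Nat.unpair_pair]
      exact mem_emitted_heavyEnum hfin.toFinset (fun y hy => hfin.mem_toFinset.1 hy) hl₁
    · simp only [Nat.unpair_pair]
      exact encard_emitted_heavyEnum hlk (by rw [hE]; exact hcard)
  -- The error `8 * L` consists of `2 * L` for cutting the program of the pair, `2 * L` for `k`, and
  -- `4 * L` for the pair of `k` and `l`.
  omega

end InfoNet

/-! ### The lower bound -/

namespace InfoNet

/-- Supplies the number of digits for parameters of size linear in the lengths, at a cost of log n +
O(1). -/
theorem exists_log_bound (A : ℕ) : ∃ B : ℝ, 0 ≤ B ∧ ∀ n : ℕ, ∃ L : ℕ,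
    A * (n + 1) ≤ 2 ^ L ∧ (L : ℝ) ≤ Real.logb 2 ((n : ℝ) + 2) + B := by
  refine ⟨1 + Real.logb 2 (A + 1), ?_, fun n => ⟨Nat.clog 2 (A * (n + 1) + 1), ?_, ?_⟩⟩
  · have : 0 ≤ Real.logb 2 ((A : ℝ) + 1) := Real.logb_nonneg (by norm_num) (by simp)
    linarith
  · exact (Nat.le_succ _).trans (Nat.le_pow_clog (by norm_num) _)
  · set L := Nat.clog 2 (A * (n + 1) + 1) with hL
    rcases Nat.eq_zero_or_pos L with h0 | hpos
    · rw [h0]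
      have h₁ : 0 ≤ Real.logb 2 ((A : ℝ) + 1) := Real.logb_nonneg (by norm_num) (by simp)
      have h₂ : 0 ≤ Real.logb 2 ((n : ℝ) + 2) :=
        Real.logb_nonneg (by norm_num) (by linarith [(Nat.cast_nonneg n : (0 : ℝ) ≤ n)])
      push_cast
      linarith
    · have h : 2 ^ (L - 1) < A * (n + 1) + 1 := by
        by_contra hle
        have := Nat.clog_le_of_le_pow (not_lt.1 hle)
        omega
      have h' : (2 : ℝ) ^ (L - 1) ≤ ((n : ℝ) + 2) * (A + 1) := by
        have : 2 ^ (L - 1) ≤ (n + 2) * (A + 1) := by nlinarith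
        exact_mod_cast this
      have hlog := Real.logb_le_logb_of_le (b := 2) (by norm_num) (by positivity) h'
      rw [Real.logb_mul (by positivity) (by positivity), Real.logb_pow,
        Real.logb_self_eq_one (by norm_num), mul_one, Nat.cast_sub hpos] at hlog
      push_cast at hlog
      linarith

theorem length_le_maxLen {l : List Str} {s : Str} (h : s ∈ l) : s.length ≤ maxLen l := by
  induction l with
  | nil => simp at h
  | cons t l ih =>
    have e : maxLen (t :: l) = max t.length (maxLen l) := rfl
    rw [e]
    rcases List.mem_cons.1 h with rfl | h
    · exact le_max_left _ _
    · exact (ih h).trans (le_max_right _ _)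

/-- The chain `y` → `q` → `z` bounds C(z|y) through C(q) ≤ C(p,q); the chain `x` → `(y, z)` → `p` →
`q` bounds C(p,q|x). Every last link is cheap and is paid for twice. -/
theorem IsOptimal.plainC_pair_sub_le {U : Lang} (hU : IsOptimal U) :
    ∃ c, ∀ x y z p q : Str,
      condC U z y + condC U (pair p q) x ≤ plainC U (pair p q) + condC U (pair y z) x +
        2 * (condC U p (pair x (pair y z)) + condC U q (pair x (pair y z)) +
          condC U z (pair q y)) + c := by
  open Primrec in
  obtain ⟨c₁, h₁⟩ := hU.condC_bind_le (g := fun s => pair s.2 s.1) (h := fun s => s.2.2)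
    (primrec_pair.comp snd fst) (snd.comp snd)
  open Primrec in
  obtain ⟨c₂, h₂⟩ := hU.condC_map_le (f := fun s => unpairSnd s.1) (e := fun _ => [])
    (primrec_unpairSnd.comp fst) (const _)
  open Primrec in
  obtain ⟨c₃, h₃⟩ := hU.condC_bind_le (g := fun s => pair s.1 s.2)
    (h := fun s => pair s.2.1 s.2.2) (primrec_pair.comp fst snd)
    (primrec_pair.comp (fst.comp snd) (snd.comp snd))
  open Primrec in
  obtain ⟨c₄, h₄⟩ := hU.condC_bind_le (g := fun s => pair s.1 (unpairFst s.2))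
    (h := fun s => pair (unpairSnd s.2.1) s.2.2)
    (primrec_pair.comp fst (primrec_unpairFst.comp snd))
    (primrec_pair.comp (primrec_unpairSnd.comp (fst.comp snd)) (snd.comp snd))
  refine ⟨c₁ + c₂ + c₃ + c₄, fun x y z p q => ?_⟩
  have e₁ := h₁ y q z
  have e₂ := h₂ (pair p q) y
  have e₃ := h₃ x (pair y z) p
  have e₄ := h₄ x (pair (pair y z) p) q
  simp only [unpairFst_pair, unpairSnd_pair] at e₁ e₂ e₃ e₄
  unfold plainC
  omega

theorem privateDisclosure_isLowerBound :
    IsLowerBound privateDisclosure (fun (U : Lang) (x y z : Str) =>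
      max 0 ((condC U z y : ℤ) - (condC U (pair y z) x : ℤ))) := by
  -- `6` is twice the three complexities below ε that are used; `8` comes from symmetry of
  -- information.
  refine ⟨6, 8, fun U hU => ?_⟩
  obtain ⟨c₁, h₁⟩ := hU.plainC_pair_sub_le
  obtain ⟨c₂, h₂⟩ := hU.symmetry_of_information
  obtain ⟨c₃, h₃⟩ := hU.condC_map_le (f := fun s => s.1) (e := fun _ => [])
    Primrec.fst (Primrec.const _)
  obtain ⟨B, hB, hlog⟩ := exists_log_bound (7 + c₂)
  refine ⟨8 * B + c₁ + c₂ + c₃, fun x y z p q ε ⟨hp, hq, _, hz⟩ => ?_⟩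
  set m := maxLen [x, y, z, p, q] with hm
  have hx : x.length ≤ m := length_le_maxLen (by simp)
  have hpl : p.length ≤ m := length_le_maxLen (by simp)
  have hql : q.length ≤ m := length_le_maxLen (by simp)
  obtain ⟨L, hL, hLm⟩ := hlog m
  have e₁ := h₁ x y z p q
  have e₂ := h₂ L (pair p q) x (by rw [length_pair]; nlinarith)
  have e₃ := h₃ x (pair p q)
  have hε : 0 ≤ ε := (Nat.cast_nonneg _).trans hp.le
  have hm0 : 0 ≤ Real.logb 2 ((m : ℝ) + 2) :=
    Real.logb_nonneg (by norm_num) (by linarith [(Nat.cast_nonneg m : (0 : ℝ) ≤ m)])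
  have r₁ : (condC U z y : ℝ) + condC U (pair p q) x ≤ plainC U (pair p q) + condC U (pair y z) x +
        2 * (condC U p (pair x (pair y z)) + condC U q (pair x (pair y z)) +
          condC U z (pair q y)) + c₁ := by exact_mod_cast e₁
  have r₂ : (plainC U (pair p q) : ℝ) + condC U x (pair p q) ≤
      plainC U x + condC U (pair p q) x + 8 * L + c₂ := by exact_mod_cast e₂
  have r₃ : (condC U x (pair p q) : ℝ) ≤ plainC U x + c₃ := by exact_mod_cast e₃
  have n₁ : (0 : ℝ) ≤ c₁ := Nat.cast_nonneg _
  have n₂ : (0 : ℝ) ≤ c₂ := Nat.cast_nonneg _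
  have n₃ : (0 : ℝ) ≤ c₃ := Nat.cast_nonneg _
  unfold privateDisclosure info
  push_cast
  -- When the maximum is 0, `r₃` suffices; otherwise `r₁` and `r₂` are added.
  rcases max_cases (0 : ℝ) ((condC U z y : ℝ) - condC U (pair y z) x) with h | h <;>
    rw [h.1] <;> linarith

end InfoNet

/-! ### Hash tables in which few elements of a sequence collide with earlier ones -/

namespace InfoNet

/-- The hash value of `w` modulo `M` is the hash value of an element of the list `σ`, to which
`w` does not belong. -/
def collides (h : ℕ → ℕ) (M : ℕ) (σ : List ℕ) (w : ℕ) : Bool :=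
  !decide (w ∈ σ) && σ.any fun v => decide (h v % M = h w % M)

/-- The number of elements of a list that collide with later elements of the list. -/
def collCount (h : ℕ → ℕ) (M : ℕ) : List ℕ → ℕ
  | [] => 0
  | w :: σ => collCount h M σ + if collides h M σ w then 1 else 0

/-- At least one third of the hash functions `H i` with `i < D` collide at `w`. -/
def isBad (H : ℕ → ℕ → ℕ) (D M : ℕ) (σ : List ℕ) (w : ℕ) : Bool :=
  decide (D ≤ 3 * (List.range D).countP fun i => collides (H i) M σ w)

/-- The number of the elements of a list that are bad with respect to the later elements. -/
def badCount (H : ℕ → ℕ → ℕ) (D M : ℕ) : List ℕ → ℕ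
  | [] => 0
  | w :: σ => badCount H D M σ + if isBad H D M σ w then 1 else 0

/-- Double counting: each bad element accounts for at least `D / 3` collisions over the table. -/
theorem badCount_mul_le (H : ℕ → ℕ → ℕ) (D M : ℕ) (σ : List ℕ) :
    badCount H D M σ * D ≤ 3 * ∑ i ∈ Finset.range D, collCount (H i) M σ := by
  induction σ with
  | nil => simp [badCount]
  | cons w σ ih =>
    simp only [badCount, collCount, Finset.sum_add_distrib, add_mul, mul_add]
    refine Nat.add_le_add ih ?_
    split_ifs with h
    · have h := of_decide_eq_true h
      have e : (List.range D).countP (fun i => collides (H i) M σ w)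
          = ∑ i ∈ Finset.range D, if collides (H i) M σ w then 1 else 0 := by
        rw [← Finset.card_filter, List.countP_eq_length_filter,
          ← List.toFinset_card_of_nodup (List.nodup_range.filter _)]
        congr 1
        ext i
        simp
      rw [one_mul, ← e]
      exact h
    · simp

theorem collides_congr {h h' : ℕ → ℕ} (M : ℕ) {σ : List ℕ} {w : ℕ}
    (hh : ∀ v ∈ w :: σ, h v = h' v) : collides h M σ w = collides h' M σ w := by
  unfold collides
  congr 1
  rw [Bool.eq_iff_iff]
  simp only [List.any_eq_true, decide_eq_true_eq]
  refine exists_congr fun v => and_congr_right fun hv => ?_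
  rw [hh v (List.mem_cons_of_mem _ hv), hh w List.mem_cons_self]

theorem collCount_congr {h h' : ℕ → ℕ} (M : ℕ) {σ : List ℕ} (hh : ∀ v ∈ σ, h v = h' v) :
    collCount h M σ = collCount h' M σ := by
  induction σ with
  | nil => rfl
  | cons w σ ih =>
    have e := collides_congr M hh
    simp only [collCount, e, ih fun v hv => hh v (List.mem_cons_of_mem _ hv)]

/-! ### Exponential moments of collision counts of random hash functions -/

section Averaging

variable {ι β : Type*} [Fintype ι] [DecidableEq ι] [Fintype β]

/-- Exchanging `g w` with `a` is an involution on pairs `(g, a)`, so resampling one coordinate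
preserves the sum. -/
theorem sum_sum_update (w : ι) (F : (ι → β) → ℝ) :
    ∑ g : ι → β, ∑ a : β, F (Function.update g w a) = Fintype.card β * ∑ g, F g := by
  have hinv : Function.Involutive fun s : (ι → β) × β => (Function.update s.1 w s.2, s.1 w) := by
    rintro ⟨g, a⟩
    simp
  have h := Equiv.sum_comp hinv.toPerm fun s : (ι → β) × β => F s.1
  rw [Fintype.sum_prod_type, Fintype.sum_prod_type] at h
  simp only [Function.Involutive.coe_toPerm] at h
  rw [h, Finset.mul_sum]
  simp

/-- The value at `w` is uniform and independent of `f` and `T`, so the event has conditional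
probability at most `c`. -/
theorem sum_mul_indicator_le [Nonempty β] (w : ι) {f : (ι → β) → ℝ} {T : (ι → β) → Finset β}
    {c : ℝ} (hf : ∀ g a, f (Function.update g w a) = f g)
    (hT : ∀ g a, T (Function.update g w a) = T g) (hf₀ : ∀ g, 0 ≤ f g)
    [DecidableEq β] (hc : ∀ g, ((T g).card : ℝ) ≤ c * Fintype.card β) :
    ∑ g, f g * (if g w ∈ T g then 1 else 0) ≤ c * ∑ g, f g := by
  have hpos : (0 : ℝ) < Fintype.card β := by exact_mod_cast Fintype.card_pos
  refine le_of_mul_le_mul_left ?_ hpos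
  rw [← sum_sum_update w, mul_left_comm, Finset.mul_sum, Finset.mul_sum]
  refine Finset.sum_le_sum fun g _ => ?_
  simp only [hf, hT, Function.update_self]
  rw [← Finset.mul_sum, Finset.sum_ite_mem, Finset.univ_inter]
  simp only [Finset.sum_const, nsmul_eq_mul, mul_one]
  nlinarith [mul_le_mul_of_nonneg_left (hc g) (hf₀ g)]

end Averaging

/-- The extension of a function on `Fin W` by zero. -/
def extendFin {W R : ℕ} (g : Fin W → Fin R) (v : ℕ) : ℕ :=
  if h : v < W then g ⟨v, h⟩ else 0

/-- As `M` divides `R`, each residue is taken exactly `R / M` times. -/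
theorem card_filter_mod_mem_le {R M : ℕ} (hM : 0 < M) (hMR : M ∣ R) (T : Finset ℕ) :
    ((Finset.univ.filter fun a : Fin R => (a : ℕ) % M ∈ T).card : ℝ) ≤ T.card / M * R := by
  obtain ⟨Q, rfl⟩ := hMR
  have h : (Finset.univ.filter fun a : Fin (M * Q) => (a : ℕ) % M ∈ T).card
      ≤ (T ×ˢ Finset.range Q).card := by
    refine Finset.card_le_card_of_injOn (fun a => ((a : ℕ) % M, (a : ℕ) / M)) ?_ ?_
    · intro a ha
      have ha := (Finset.mem_filter.1 (Finset.mem_coe.1 ha)).2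
      simp only [Finset.coe_product, Set.mem_prod, Finset.mem_coe, Finset.mem_range]
      exact ⟨ha, Nat.div_lt_of_lt_mul a.2⟩
    · intro a _ b _ hab
      simp only [Prod.mk.injEq] at hab
      exact Fin.ext (by rw [← Nat.mod_add_div (a : ℕ) M, hab.1, hab.2, Nat.mod_add_div])
  rw [Finset.card_product, Finset.card_range] at h
  have hM' : (M : ℝ) ≠ 0 := by positivity
  have h' : ((Finset.univ.filter fun a : Fin (M * Q) => (a : ℕ) % M ∈ T).card : ℝ)
      ≤ T.card * Q := by exact_mod_cast h
  refine h'.trans (le_of_eq ?_)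
  push_cast
  field_simp

/-- Given the hash values of the earlier elements, a new one collides with probability at most `S /
M`, and a collision multiplies the term by `X`. Hence each element multiplies the mean by at most `1
+ X * (S / M)`; repeated elements never collide. -/
theorem sum_pow_collCount_le {W R M S : ℕ} (hM : 0 < M) (hMR : M ∣ R) (hR : 0 < R) {X : ℝ}
    (hX : 1 ≤ X) {σ : List ℕ} (hσ : ∀ v ∈ σ, v < W) (hS : σ.length ≤ S) :
    ∑ g : Fin W → Fin R, X ^ collCount (extendFin g) M σ
      ≤ Fintype.card (Fin W → Fin R) * (1 + X * (S / M)) ^ σ.length := by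
  have : Nonempty (Fin R) := ⟨⟨0, hR⟩⟩
  induction σ with
  | nil => simp [collCount]
  | cons w σ ih =>
    have ih := ih (fun v hv => hσ v (List.mem_cons_of_mem _ hv))
      ((Nat.le_succ _).trans hS)
    have hq : 0 ≤ X * (S / M) := by positivity
    by_cases hw : w ∈ σ
    · have e : ∀ h : ℕ → ℕ, collCount h M (w :: σ) = collCount h M σ := fun h => by
        simp [collCount, collides, hw]
      simp only [e]
      refine ih.trans ?_
      rw [List.length_cons]
      gcongr
      · linarith
      · omega
    · have hwW : w < W := hσ w List.mem_cons_self
      set T : (Fin W → Fin R) → Finset (Fin R) := fun g =>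
        Finset.univ.filter fun a : Fin R =>
          (a : ℕ) % M ∈ (σ.map fun v => extendFin g v % M).toFinset with hTdef
      have hupd : ∀ (g : Fin W → Fin R) (a : Fin R), ∀ v ∈ σ,
          extendFin (Function.update g ⟨w, hwW⟩ a) v = extendFin g v := by
        intro g a v hv
        have hne : v ≠ w := fun h => hw (h ▸ hv)
        unfold extendFin
        split_ifs with h
        · rw [Function.update_of_ne (by simpa using hne)]
        · rfl
      have key := sum_mul_indicator_le (⟨w, hwW⟩ : Fin W)
        (f := fun g : Fin W → Fin R => X ^ collCount (extendFin g) M σ) (T := T) (c := S / M)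
        (fun g a => by
          rw [collCount_congr M (hupd g a)])
        (fun g a => by
          simp only [hTdef]
          rw [List.map_congr_left (g := fun v => extendFin g v % M)
            fun v hv => by rw [hupd g a v hv]])
        (fun g => by positivity)
        (fun g => by
          refine (card_filter_mod_mem_le hM hMR _).trans ?_
          rw [Fintype.card_fin]
          have h₁ : ((σ.map fun v => extendFin g v % M).toFinset.card : ℝ) ≤ S := by
            have := List.toFinset_card_le (σ.map fun v => extendFin g v % M)
            rw [List.length_map] at this
            rw [List.length_cons] at hS
            exact_mod_cast this.trans (by omega)
          gcongr)
      have hle : ∀ g : Fin W → Fin R, X ^ collCount (extendFin g) M (w :: σ) ≤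
          X ^ collCount (extendFin g) M σ + X * (X ^ collCount (extendFin g) M σ *
            (if g ⟨w, hwW⟩ ∈ T g then 1 else 0)) := by
        intro g
        have hiff : collides (extendFin g) M σ w = true ↔ g ⟨w, hwW⟩ ∈ T g := by
          have e : extendFin g w = g ⟨w, hwW⟩ := dif_pos hwW
          simp [collides, hw, hTdef, e]
        have hp : 0 ≤ X ^ collCount (extendFin g) M σ := by positivity
        simp only [collCount]
        by_cases hc : collides (extendFin g) M σ w = true
        · rw [if_pos hc, if_pos (hiff.1 hc), pow_succ]
          linarith
        · rw [if_neg hc, if_neg fun h => hc (hiff.2 h)]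
          simp
      calc ∑ g : Fin W → Fin R, X ^ collCount (extendFin g) M (w :: σ)
          ≤ ∑ g : Fin W → Fin R, (X ^ collCount (extendFin g) M σ +
              X * (X ^ collCount (extendFin g) M σ * (if g ⟨w, hwW⟩ ∈ T g then 1 else 0))) :=
            Finset.sum_le_sum fun g _ => hle g
        _ = ∑ g : Fin W → Fin R, X ^ collCount (extendFin g) M σ + X *
              ∑ g : Fin W → Fin R, X ^ collCount (extendFin g) M σ *
                (if g ⟨w, hwW⟩ ∈ T g then 1 else 0) := by
            rw [Finset.sum_add_distrib, Finset.mul_sum]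
        _ ≤ ∑ g : Fin W → Fin R, X ^ collCount (extendFin g) M σ + X *
              (S / M * ∑ g : Fin W → Fin R, X ^ collCount (extendFin g) M σ) := by gcongr
        _ = (1 + X * (S / M)) * ∑ g : Fin W → Fin R, X ^ collCount (extendFin g) M σ := by ring
        _ ≤ (1 + X * (S / M)) * (Fintype.card (Fin W → Fin R) *
              (1 + X * (S / M)) ^ σ.length) := by gcongr
        _ = _ := by rw [List.length_cons, pow_succ]; ring

/-- The lists of length at most `n` of numbers less than `W`. -/
def listsUpTo (W : ℕ) : ℕ → List (List ℕ)
  | 0 => [[]]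
  | n + 1 => [] :: (listsUpTo W n).flatMap fun σ => (List.range W).map fun w => w :: σ

theorem mem_listsUpTo {W n : ℕ} {σ : List ℕ} :
    σ ∈ listsUpTo W n ↔ σ.length ≤ n ∧ ∀ v ∈ σ, v < W := by
  induction n generalizing σ with
  | zero =>
    simp only [listsUpTo, List.mem_singleton, Nat.le_zero, List.length_eq_zero_iff]
    exact ⟨fun h => ⟨h, by simp [h]⟩, fun h => h.1⟩
  | succ n ih =>
    simp only [listsUpTo, List.mem_cons, List.mem_flatMap, List.mem_map, List.mem_range]
    cases σ with
    | nil => simp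
    | cons w σ =>
      simp only [reduceCtorEq, false_or, List.length_cons, List.cons.injEq, List.mem_cons,
        forall_eq_or_imp, Nat.add_le_add_iff_right]
      constructor
      · rintro ⟨τ, hτ, v, hv, rfl, rfl⟩
        exact ⟨(ih.1 hτ).1, hv, (ih.1 hτ).2⟩
      · rintro ⟨h₁, h₂, h₃⟩
        exact ⟨σ, ih.2 ⟨h₁, h₃⟩, w, h₂, rfl, rfl⟩

theorem length_listsUpTo_le (W n : ℕ) : (listsUpTo W n).length ≤ (W + 1) ^ n := by
  induction n with
  | zero => simp [listsUpTo]
  | succ n ih =>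
    have e : (listsUpTo W (n + 1)).length = (listsUpTo W n).length * W + 1 := by
      simp [listsUpTo, List.length_flatMap]
    have hpos : 1 ≤ (W + 1) ^ n := Nat.one_le_pow _ _ (by omega)
    rw [e, pow_succ]
    nlinarith

/-- In the table of hash functions `H i` with `i < D` only few elements of a sequence of numbers
less than `2 ^ N` are bad, for all moduli. -/
def IsGoodTable (N δ : ℕ) (H : ℕ → ℕ → ℕ) : Prop :=
  ∀ k < N + 1, ∀ σ ∈ listsUpTo (2 ^ N) (2 ^ k),
    badCount H (2 ^ δ * (N + 1)) (2 ^ (k + δ + 12)) σ * 2 ^ δ ≤ 2 ^ k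

/-- The hash functions given by a finite table. -/
def extendTable {D W R : ℕ} (G : Fin D → Fin W → Fin R) (i : ℕ) : ℕ → ℕ :=
  if h : i < D then extendFin (G ⟨i, h⟩) else fun _ => 0

/-! ### Existence of good tables -/

theorem one_add_inv_pow_le (n : ℕ) (hn : 0 < n) : (1 + (n : ℝ)⁻¹) ^ n ≤ 4 := by
  have h : (1 + (n : ℝ)⁻¹) ^ n ≤ Real.exp (n : ℝ)⁻¹ ^ n := by
    gcongr
    linarith [Real.add_one_le_exp (n : ℝ)⁻¹]
  rw [← Real.exp_nat_mul, mul_inv_cancel₀ (by positivity)] at h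
  linarith [Real.exp_one_lt_d9]

/-- Markov's inequality for the moment with base `2 ^ 12`. Let Q = `2 ^ k * (N + 1)`. The rows are
independent, so the mean is at most `4 ^ Q`, whereas a table with too many bad elements has at least
Q/3 collisions, hence a term of at least `16 ^ Q`. -/
theorem card_bad_tables_le {N δ k : ℕ} (hk : k ≤ N) {σ : List ℕ} (hσ : ∀ v ∈ σ, v < 2 ^ N)
    (hlen : σ.length ≤ 2 ^ k) :
    (((Finset.univ : Finset (Fin (2 ^ δ * (N + 1)) → Fin (2 ^ N) → Fin (2 ^ (N + δ + 12)))).filter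
      fun G => 2 ^ k < badCount (extendTable G) (2 ^ δ * (N + 1)) (2 ^ (k + δ + 12)) σ *
        2 ^ δ).card : ℝ) * 4 ^ (2 ^ k * (N + 1)) ≤
      Fintype.card (Fin (2 ^ δ * (N + 1)) → Fin (2 ^ N) → Fin (2 ^ (N + δ + 12))) := by
  set D := 2 ^ δ * (N + 1) with hD
  set M := 2 ^ (k + δ + 12) with hM
  set R := 2 ^ (N + δ + 12) with hR
  set Ω := Fin D → Fin (2 ^ N) → Fin R
  set B := (Finset.univ : Finset Ω).filter
    fun G => 2 ^ k < badCount (extendTable G) D M σ * 2 ^ δ with hB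
  have hrow : ∑ g : Fin (2 ^ N) → Fin R, ((2 : ℝ) ^ 12) ^ collCount (extendFin g) M σ
      ≤ Fintype.card (Fin (2 ^ N) → Fin R) * (1 + ((2 ^ δ : ℕ) : ℝ)⁻¹) ^ 2 ^ k := by
    refine (sum_pow_collCount_le (X := 2 ^ 12) (by positivity)
      (Nat.pow_dvd_pow 2 (by omega)) (by positivity) (by norm_num) hσ hlen).trans ?_
    -- The base of the moment cancels the 12 extra digits of the modulus, leaving `2 ^ (-δ)`; with
    -- `2 ^ δ` rows per unit the product stays bounded by a power of 4.
    have e : (2 : ℝ) ^ 12 * (((2 ^ k : ℕ) : ℝ) / (M : ℕ)) = ((2 ^ δ : ℕ) : ℝ)⁻¹ := by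
      rw [hM]
      push_cast
      rw [pow_add, pow_add]
      field_simp
    rw [e]
    gcongr
    linarith [inv_nonneg.2 (Nat.cast_nonneg (α := ℝ) (2 ^ δ))]
  have hsum : ∑ G : Ω, ((2 : ℝ) ^ 12) ^ (∑ i ∈ Finset.range D, collCount (extendTable G i) M σ)
      ≤ Fintype.card Ω * 4 ^ (2 ^ k * (N + 1)) := by
    have e : ∀ G : Ω, ((2 : ℝ) ^ 12) ^ (∑ i ∈ Finset.range D, collCount (extendTable G i) M σ)
        = ∏ i : Fin D, ((2 : ℝ) ^ 12) ^ collCount (extendFin (G i)) M σ := by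
      intro G
      rw [Finset.prod_pow_eq_pow_sum, Finset.sum_range]
      congr 1
      refine Finset.sum_congr rfl fun i _ => ?_
      simp [extendTable]
    simp only [e]
    rw [← Fintype.sum_pow (fun g => ((2 : ℝ) ^ 12) ^ collCount (extendFin g) M σ)]
    refine (pow_le_pow_left₀ (Finset.sum_nonneg fun _ _ => by positivity) hrow _).trans ?_
    have hexp : 2 ^ k * D = 2 ^ δ * (2 ^ k * (N + 1)) := by rw [hD]; ring
    rw [mul_pow, ← pow_mul, hexp, pow_mul (1 + ((2 ^ δ : ℕ) : ℝ)⁻¹) (2 ^ δ)]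
    have hc : (Fintype.card Ω : ℝ) = (Fintype.card (Fin (2 ^ N) → Fin R) : ℝ) ^ D := by
      rw [Fintype.card_fun (α := Fin D), Fintype.card_fin]
      push_cast
      rfl
    rw [hc]
    gcongr
    exact one_add_inv_pow_le (2 ^ δ) (by positivity)
  have hlarge : ∀ G ∈ B, (4 : ℝ) ^ (2 ^ k * (N + 1)) * 4 ^ (2 ^ k * (N + 1)) ≤
      ((2 : ℝ) ^ 12) ^ (∑ i ∈ Finset.range D, collCount (extendTable G i) M σ) := by
    intro G hG
    have h₁ := (Finset.mem_filter.1 hG).2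
    have h₂ := badCount_mul_le (extendTable G) D M σ
    set s := ∑ i ∈ Finset.range D, collCount (extendTable G i) M σ
    set b := badCount (extendTable G) D M σ
    have h₃ : 2 ^ k * (N + 1) ≤ 3 * s := by
      refine le_trans (Nat.mul_le_mul_right _ h₁.le) ?_
      rw [mul_assoc, ← hD]
      exact h₂
    have h4 : (4 : ℝ) = 2 ^ 2 := by norm_num
    rw [← pow_add, h4, ← pow_mul, ← pow_mul]
    exact pow_le_pow_right₀ (by norm_num) (by omega)
  have hfinal : (B.card : ℝ) * (4 ^ (2 ^ k * (N + 1)) * 4 ^ (2 ^ k * (N + 1)))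
      ≤ Fintype.card Ω * 4 ^ (2 ^ k * (N + 1)) := by
    refine le_trans ?_ hsum
    rw [← nsmul_eq_mul]
    refine (Finset.card_nsmul_le_sum B _ _ hlarge).trans ?_
    exact Finset.sum_le_univ_sum_of_nonneg fun _ => by positivity
  rw [← mul_assoc] at hfinal
  exact le_of_mul_le_mul_right hfinal (by positivity)

/-- Union bound: at most `2 ^ Q` sequences, each failing with probability at most `4 ^ (-Q)`, where
Q = `2 ^ k * (N + 1)`. Each `k` contributes at most `2 ^ (-(N + 1))`, and `N + 1 < 2 ^ (N + 1)`. -/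
theorem exists_isGoodTable (N δ : ℕ) :
    ∃ G : Fin (2 ^ δ * (N + 1)) → Fin (2 ^ N) → Fin (2 ^ (N + δ + 12)),
      IsGoodTable N δ (extendTable G) := by
  classical
  by_contra hne
  push Not at hne
  set Ω := Fin (2 ^ δ * (N + 1)) → Fin (2 ^ N) → Fin (2 ^ (N + δ + 12))
  set bad : ℕ → List ℕ → Finset Ω := fun k σ => Finset.univ.filter fun G =>
    2 ^ k < badCount (extendTable G) (2 ^ δ * (N + 1)) (2 ^ (k + δ + 12)) σ * 2 ^ δ with hbad
  have hcover : (Finset.univ : Finset Ω) ⊆ (Finset.range (N + 1)).biUnion fun k =>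
      (listsUpTo (2 ^ N) (2 ^ k)).toFinset.biUnion (bad k) := by
    intro G _
    have hG := hne G
    unfold IsGoodTable at hG
    push Not at hG
    obtain ⟨k, hk, σ, hσ, h⟩ := hG
    simp only [Finset.mem_biUnion, Finset.mem_range, List.mem_toFinset]
    exact ⟨k, hk, σ, hσ, Finset.mem_filter.2 ⟨Finset.mem_univ _, h⟩⟩
  have hpos : (0 : ℝ) < Fintype.card Ω := by
    have : Nonempty Ω := ⟨fun _ _ => ⟨0, by positivity⟩⟩
    exact_mod_cast Fintype.card_pos
  have hk : ∀ k ∈ Finset.range (N + 1),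
      ((((listsUpTo (2 ^ N) (2 ^ k)).toFinset.biUnion (bad k)).card : ℕ) : ℝ) ≤
        Fintype.card Ω / 2 ^ (N + 1) := by
    intro k hk
    have hk : k ≤ N := Nat.lt_succ_iff.1 (Finset.mem_range.1 hk)
    have h₁ : ((((listsUpTo (2 ^ N) (2 ^ k)).toFinset.biUnion (bad k)).card : ℕ) : ℝ) ≤
        ((listsUpTo (2 ^ N) (2 ^ k)).toFinset.card : ℝ) *
          (Fintype.card Ω / 4 ^ (2 ^ k * (N + 1))) := by
      refine (Nat.cast_le.2 Finset.card_biUnion_le).trans ?_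
      push_cast
      rw [← nsmul_eq_mul]
      refine Finset.sum_le_card_nsmul _ _ _ fun σ hσ => ?_
      have hσ := mem_listsUpTo.1 (List.mem_toFinset.1 hσ)
      rw [le_div_iff₀ (by positivity)]
      exact card_bad_tables_le hk hσ.2 hσ.1
    have h₂ : ((listsUpTo (2 ^ N) (2 ^ k)).toFinset.card : ℝ) ≤ 2 ^ (2 ^ k * (N + 1)) := by
      have h := (List.toFinset_card_le _).trans (length_listsUpTo_le (2 ^ N) (2 ^ k))
      have h' : (2 ^ N + 1) ^ 2 ^ k ≤ 2 ^ (2 ^ k * (N + 1)) := by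
        rw [mul_comm, pow_mul]
        refine Nat.pow_le_pow_left ?_ _
        have := Nat.one_le_two_pow (n := N)
        rw [pow_succ]
        omega
      exact_mod_cast h.trans h'
    refine h₁.trans ?_
    have h4 : (4 : ℝ) ^ (2 ^ k * (N + 1)) = 2 ^ (2 ^ k * (N + 1)) * 2 ^ (2 ^ k * (N + 1)) := by
      rw [← mul_pow]; norm_num
    have h₃ : (2 : ℝ) ^ (N + 1) ≤ 2 ^ (2 ^ k * (N + 1)) :=
      pow_le_pow_right₀ (by norm_num) (Nat.le_mul_of_pos_left _ (by positivity))
    calc _ ≤ (2 : ℝ) ^ (2 ^ k * (N + 1)) * (Fintype.card Ω / 4 ^ (2 ^ k * (N + 1))) := by gcongr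
      _ = Fintype.card Ω / 2 ^ (2 ^ k * (N + 1)) := by rw [h4]; field_simp
      _ ≤ _ := by gcongr
  have htotal : (Fintype.card Ω : ℝ) ≤ (N + 1) * (Fintype.card Ω / 2 ^ (N + 1)) := by
    have h := (Finset.card_le_card hcover).trans Finset.card_biUnion_le
    rw [Finset.card_univ] at h
    have h' : (Fintype.card Ω : ℝ) ≤ ∑ k ∈ Finset.range (N + 1),
        ((((listsUpTo (2 ^ N) (2 ^ k)).toFinset.biUnion (bad k)).card : ℕ) : ℝ) := by
      exact_mod_cast h
    refine h'.trans ((Finset.sum_le_card_nsmul _ _ _ hk).trans (le_of_eq ?_))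
    rw [Finset.card_range, nsmul_eq_mul]
    push_cast
    ring
  have hlt : ((N : ℝ) + 1) < 2 ^ (N + 1) := by exact_mod_cast Nat.lt_two_pow_self (n := N + 1)
  have hlt' : ((N : ℝ) + 1) * (Fintype.card Ω / 2 ^ (N + 1)) < Fintype.card Ω := by
    rw [mul_div_assoc', div_lt_iff₀ (by positivity), mul_comm]
    exact mul_lt_mul_of_pos_left hlt hpos
  linarith

end InfoNet

/-! ### Computing good tables -/

namespace InfoNet

open Primrec in
theorem primrec_collides {α : Type*} [Primcodable α] {h : α → ℕ → ℕ} {M w : α → ℕ}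
    {σ : α → List ℕ} (hh : Primrec₂ h) (hM : Primrec M) (hσ : Primrec σ) (hw : Primrec w) :
    Primrec fun a => collides (h a) (M a) (σ a) (w a) :=
  Primrec.and.comp (Primrec.not.comp ((list_contains.comp hσ hw).of_eq
      fun _ => decide_eq_decide.2 Iff.rfl))
    (list_any hσ (Primrec.eq.comp (nat_mod.comp (hh.comp fst snd) (hM.comp fst))
      (nat_mod.comp (hh.comp fst (hw.comp fst)) (hM.comp fst))).decide.to₂)

open Primrec in
theorem primrec_isBad {α : Type*} [Primcodable α] {H : α → ℕ → ℕ → ℕ} {D M w : α → ℕ}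
    {σ : α → List ℕ} (hH : Primrec fun s : (α × ℕ) × ℕ => H s.1.1 s.1.2 s.2) (hD : Primrec D)
    (hM : Primrec M) (hσ : Primrec σ) (hw : Primrec w) :
    Primrec fun a => isBad (H a) (D a) (M a) (σ a) (w a) := by
  have hc : Primrec₂ fun (a : α) (i : ℕ) => collides (H a i) (M a) (σ a) (w a) :=
    primrec_collides (α := α × ℕ) (h := fun s v => H s.1 s.2 v) hH (hM.comp fst) (hσ.comp fst)
      (hw.comp fst)
  exact (nat_le.comp hD (nat_mul.comp (const 3) (list_countP (list_range.comp hD) hc))).decide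

open Primrec in
theorem primrec_badCount {α : Type*} [Primcodable α] {H : α → ℕ → ℕ → ℕ} {D M : α → ℕ}
    {σ : α → List ℕ} (hH : Primrec fun s : (α × ℕ) × ℕ => H s.1.1 s.1.2 s.2) (hD : Primrec D)
    (hM : Primrec M) (hσ : Primrec σ) :
    Primrec fun a => badCount (H a) (D a) (M a) (σ a) := by
  have hb : Primrec fun s : α × ℕ × List ℕ × ℕ =>
      isBad (H s.1) (D s.1) (M s.1) s.2.2.1 s.2.1 :=
    primrec_isBad (hH.comp (((fst.comp (fst.comp fst)).pair (snd.comp fst)).pair snd))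
      (hD.comp fst) (hM.comp fst) (fst.comp (snd.comp snd)) (fst.comp snd)
  have hstep : Primrec₂ fun (a : α) (s : ℕ × List ℕ × ℕ) =>
      s.2.2 + cond (isBad (H a) (D a) (M a) s.2.1 s.1) 1 0 :=
    nat_add.comp (snd.comp (snd.comp snd)) (Primrec.cond hb (const 1) (const 0))
  refine (list_rec hσ (const 0) hstep).of_eq fun a => ?_
  induction σ a with
  | nil => rfl
  | cons w τ ih =>
    simp only [badCount] at ih ⊢
    rw [ih]
    cases isBad (H a) (D a) (M a) τ w <;> rfl

open Primrec in
theorem primrec_listsUpTo : Primrec₂ listsUpTo := by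
  have hstep : Primrec₂ fun (W : ℕ) (s : ℕ × List (List ℕ)) =>
      ([] : List ℕ) :: s.2.flatMap fun σ => (List.range W).map fun w => w :: σ := by
    refine list_cons.comp (const _) (list_flatMap (snd.comp snd) ?_)
    exact list_map (list_range.comp (fst.comp fst)) (list_cons.comp snd (snd.comp fst)).to₂
  refine (nat_rec (const [[]]) hstep).of_eq fun W n => ?_
  induction n with
  | zero => rfl
  | succ n ih => simp only [listsUpTo] at ih ⊢; rw [ih]

/-- The hash functions given by a list of values, for arguments less than `W`. -/
def listHash (W : ℕ) (t : List ℕ) (i w : ℕ) : ℕ := t.getD (i * W + w) 0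

theorem badCount_congr {H H' : ℕ → ℕ → ℕ} {D : ℕ} (M : ℕ) {σ : List ℕ}
    (hH : ∀ i < D, ∀ v ∈ σ, H i v = H' i v) : badCount H D M σ = badCount H' D M σ := by
  induction σ with
  | nil => rfl
  | cons w σ ih =>
    have e : isBad H D M σ w = isBad H' D M σ w := by
      unfold isBad
      congr 3
      refine List.countP_congr fun i hi => ?_
      rw [collides_congr M (hH i (List.mem_range.1 hi))]
    simp only [badCount, e, ih fun i hi v hv => hH i hi v (List.mem_cons_of_mem _ hv)]

/-- The table is flattened into a list of numbers so that candidates can be enumerated and tested.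
-/
theorem exists_isGoodTable_listHash (N δ : ℕ) :
    ∃ t : List ℕ, IsGoodTable N δ (listHash (2 ^ N) t) := by
  obtain ⟨G, hG⟩ := exists_isGoodTable N δ
  refine ⟨(List.range (2 ^ δ * (N + 1) * 2 ^ N)).map fun e =>
    extendTable G (e / 2 ^ N) (e % 2 ^ N), fun k hk σ hσ => ?_⟩
  rw [badCount_congr (H' := extendTable G)]
  · exact hG k hk σ hσ
  · intro i hi v hv
    have hv := (mem_listsUpTo.1 hσ).2 v hv
    have hlt : i * 2 ^ N + v < 2 ^ δ * (N + 1) * 2 ^ N := by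
      calc i * 2 ^ N + v < i * 2 ^ N + 2 ^ N := by omega
        _ = (i + 1) * 2 ^ N := by ring
        _ ≤ _ := Nat.mul_le_mul_right _ hi
    have h₁ : (i * 2 ^ N + v) / 2 ^ N = i := by
      rw [mul_comm, Nat.mul_add_div (by positivity), Nat.div_eq_of_lt hv, add_zero]
    have h₂ : (i * 2 ^ N + v) % 2 ^ N = v := by
      rw [mul_comm, Nat.mul_add_mod, Nat.mod_eq_of_lt hv]
    have h₃ : (List.range (2 ^ δ * (N + 1) * 2 ^ N))[i * 2 ^ N + v]? = some (i * 2 ^ N + v) := by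
      rw [List.getElem?_range hlt]
    rw [listHash, List.getD_eq_getElem?_getD, List.getElem?_map, h₃, Option.map_some,
      Option.getD_some, h₁, h₂]

open Primrec in
theorem primrec_listHash : Primrec fun s : ((ℕ × List ℕ) × ℕ) × ℕ =>
    listHash s.1.1.1 s.1.1.2 s.1.2 s.2 :=
  (list_getD 0).comp (snd.comp (fst.comp fst))
    (nat_add.comp (nat_mul.comp (snd.comp fst) (fst.comp (fst.comp fst))) snd)

/-- The exponent of the number of arguments of the hash functions at scale `a`. -/
def argBits (a : ℕ) : ℕ := 2 ^ (a + 2)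

/-- The number of the hash functions at scale `a`. -/
def numHash (a : ℕ) : ℕ := 2 ^ (6 * a) * (argBits a + 1)

open Primrec in
theorem primrec_argBits : Primrec argBits :=
  nat_pow.comp (const 2) (nat_add.comp .id (const 2))

open Primrec in
theorem primrec_numHash : Primrec numHash :=
  nat_mul.comp (nat_pow.comp (const 2) (nat_mul.comp (const 6) .id))
    (succ.comp primrec_argBits)

/-- The hash functions at scale `a` given by a list of values. -/
def scaleHash (a : ℕ) (t : List ℕ) : ℕ → ℕ → ℕ := listHash (2 ^ argBits a) t

open Primrec in
theorem primrec_scaleHash {α : Type*} [Primcodable α] {a i w : α → ℕ} {t : α → List ℕ}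
    (ha : Primrec a) (ht : Primrec t) (hi : Primrec i) (hw : Primrec w) :
    Primrec fun s => scaleHash (a s) (t s) (i s) (w s) :=
  primrec_listHash.comp ((((nat_pow.comp (const 2) (primrec_argBits.comp ha)).pair ht).pair
    hi).pair hw)

/-- The test of one list, for a scale, a table, a logarithmic bound for lengths, and a list. -/
def testList (s : ((ℕ × List ℕ) × ℕ) × List ℕ) : Bool :=
  decide (badCount (scaleHash s.1.1.1 s.1.1.2) (numHash s.1.1.1) (2 ^ (s.1.2 + 6 * s.1.1.1 + 12))
    s.2 * 2 ^ (6 * s.1.1.1) ≤ 2 ^ s.1.2)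

/-- A test for good tables at scale `a`. -/
def testTable (a : ℕ) (t : List ℕ) : Bool :=
  (List.range (argBits a + 1)).all fun k => (listsUpTo (2 ^ argBits a) (2 ^ k)).all fun σ =>
    testList (((a, t), k), σ)

theorem testTable_iff {a : ℕ} {t : List ℕ} :
    testTable a t = true ↔ IsGoodTable (argBits a) (6 * a) (scaleHash a t) := by
  simp only [testTable, testList, List.all_eq_true, List.mem_range, decide_eq_true_eq]
  rfl

open Primrec in
theorem primrec_testList : Primrec testList := by
  have hδ : Primrec fun s : ((ℕ × List ℕ) × ℕ) × List ℕ => 6 * s.1.1.1 :=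
    nat_mul.comp (const 6) (fst.comp (fst.comp fst))
  have hk : Primrec fun s : ((ℕ × List ℕ) × ℕ) × List ℕ => s.1.2 := snd.comp fst
  have hM : Primrec fun s : ((ℕ × List ℕ) × ℕ) × List ℕ => 2 ^ (s.1.2 + 6 * s.1.1.1 + 12) :=
    nat_pow.comp (const 2) (nat_add.comp (nat_add.comp hk hδ) (const 12))
  have hH : Primrec fun s : ((((ℕ × List ℕ) × ℕ) × List ℕ) × ℕ) × ℕ =>
      scaleHash s.1.1.1.1.1 s.1.1.1.1.2 s.1.2 s.2 :=
    primrec_scaleHash (fst.comp (fst.comp (fst.comp (fst.comp fst))))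
      (snd.comp (fst.comp (fst.comp (fst.comp fst)))) (snd.comp fst) snd
  have hbc := primrec_badCount (α := ((ℕ × List ℕ) × ℕ) × List ℕ)
    (H := fun s => scaleHash s.1.1.1 s.1.1.2) (D := fun s => numHash s.1.1.1)
    (σ := fun s => s.2) hH (primrec_numHash.comp (fst.comp (fst.comp fst))) hM snd
  have hl := nat_mul.comp hbc (nat_pow.comp (const 2) hδ)
  exact (nat_le.comp hl (nat_pow.comp (const 2) hk)).decide

open Primrec in
theorem primrec_testTable : Primrec₂ testTable := by
  have hl : Primrec fun s : (ℕ × List ℕ) × ℕ => listsUpTo (2 ^ argBits s.1.1) (2 ^ s.2) :=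
    primrec_listsUpTo.comp (nat_pow.comp (const 2) (primrec_argBits.comp (fst.comp fst)))
      (nat_pow.comp (const 2) snd)
  have hall : Primrec fun s : (ℕ × List ℕ) × ℕ =>
      (listsUpTo (2 ^ argBits s.1.1) (2 ^ s.2)).all fun σ => testList (s, σ) :=
    list_all (p := fun s σ => testList (s, σ)) hl primrec_testList
  exact list_all (p := fun (s : ℕ × List ℕ) k =>
      (listsUpTo (2 ^ argBits s.1) (2 ^ k)).all fun σ => testList ((s, k), σ))
    (list_range.comp (succ.comp (primrec_argBits.comp fst))) hall

/-- Being a good table is a finite test and some table passes it, so the first one that passes is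
computable from the scale. Describing the table therefore costs nothing beyond `a`. -/
theorem exists_computable_table :
    ∃ T : ℕ → List ℕ, Computable T ∧
      ∀ a, IsGoodTable (argBits a) (6 * a) (scaleHash a (T a)) := by
  classical
  have hex : ∀ a, ∃ n, testTable a (Denumerable.ofNat (List ℕ) n) = true := by
    intro a
    obtain ⟨t, ht⟩ := exists_isGoodTable_listHash (argBits a) (6 * a)
    exact ⟨Encodable.encode t, by rw [Denumerable.ofNat_encode]; exact testTable_iff.2 ht⟩
  have hp : Partrec fun a => Nat.rfind fun n =>
      Part.some (testTable a (Denumerable.ofNat (List ℕ) n)) :=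
    Partrec.rfind (p := fun a n => Part.some (testTable a (Denumerable.ofNat (List ℕ) n)))
      (primrec_testTable.comp Primrec.fst
        ((Primrec.ofNat (List ℕ)).comp Primrec.snd)).to_comp.partrec
  have hT : Computable fun a => Nat.find (hex a) := by
    refine hp.of_eq_tot fun a => ?_
    refine Nat.mem_rfind.2 ⟨?_, fun hm => ?_⟩
    · exact Part.mem_some_iff.2 (Nat.find_spec (hex a)).symm
    · exact Part.mem_some_iff.2 (by
        have := Nat.find_min (hex a) hm
        simpa using this)
  exact ⟨fun a => Denumerable.ofNat (List ℕ) (Nat.find (hex a)),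
    (Computable.ofNat (List ℕ)).comp hT, fun a => testTable_iff.1 (Nat.find_spec (hex a))⟩

end InfoNet

/-! ### Codes: prefixes of hash values from which strings are found in enumerations -/

namespace InfoNet

/-- The enumeration of the strings of length less than `argBits a` that have a program of length
at most `k` on input `b`. -/
def shortEnum (S : ℕ × Str × Str → Option Str) (k a : ℕ) (b : Str) (m : ℕ) : Option Str :=
  (boundedEnum S (k, b) m).bind fun v => if v.length < argBits a then some v else none

open Primrec in
theorem primrec_shortEnum {α : Type*} [Primcodable α] {S : ℕ × Str × Str → Option Str}
    (hS : Primrec S) {k a m : α → ℕ} {b : α → Str} (hk : Primrec k) (ha : Primrec a)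
    (hb : Primrec b) (hm : Primrec m) :
    Primrec fun s => shortEnum S (k s) (a s) (b s) (m s) :=
  option_bind ((primrec_boundedEnum hS).comp (hk.pair hb) hm)
    (Primrec.ite (nat_lt.comp (list_length.comp snd) (primrec_argBits.comp (ha.comp fst)))
      (option_some.comp snd) (const _)).to₂

theorem IsOptimal.emitted_shortEnum {U : Lang} (hU : IsOptimal U)
    {S : ℕ × Str × Str → Option Str}
    (hS : ∀ p b v : Str, v ∈ U p b ↔ ∃ t, S (t, p, b) = some v) (k a : ℕ) (b : Str) :
    emitted (shortEnum S k a b) = {v | condC U v b ≤ k ∧ v.length < argBits a} := by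
  have hE := hU.emitted_boundedEnum hS k b
  ext v
  constructor
  · rintro ⟨m, hm⟩
    obtain ⟨v', hv', h⟩ := Option.bind_eq_some_iff.1 hm
    split_ifs at h with hlt
    obtain rfl := Option.some.inj h
    have : v' ∈ emitted (boundedEnum S (k, b)) := ⟨m, hv'⟩
    rw [hE] at this
    exact ⟨this, hlt⟩
  · rintro ⟨hv, hlt⟩
    have : v ∈ emitted (boundedEnum S (k, b)) := by rw [hE]; exact hv
    obtain ⟨m, hm⟩ := this
    exact ⟨m, by simp [shortEnum, hm, hlt]⟩

/-- The number of bits of the code at scale `a` of a string of conditional complexity `k`. -/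
def codeLength (k a : ℕ) : ℕ := k + 1 + 6 * a + 12

open Primrec in
theorem primrec_codeLength : Primrec₂ codeLength :=
  nat_add.comp (nat_add.comp (nat_add.comp fst (const 1)) (nat_mul.comp (const 6) snd)) (const 12)

/-- The string `v` is bad with respect to the list `l`, at scale `a` with the table `t`. -/
def isBadStr (t : List ℕ) (k a : ℕ) (l : List Str) (v : Str) : Bool :=
  isBad (scaleHash a t) (numHash a) (2 ^ codeLength k a) (l.map strIndex) (strIndex v)

open Primrec in
theorem primrec_isBadStr {α : Type*} [Primcodable α] {t : α → List ℕ} {k a : α → ℕ}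
    {l : α → List Str} {v : α → Str} (ht : Primrec t) (hk : Primrec k) (ha : Primrec a)
    (hl : Primrec l) (hv : Primrec v) :
    Primrec fun s => isBadStr (t s) (k s) (a s) (l s) (v s) :=
  primrec_isBad (H := fun s => scaleHash (a s) (t s))
    (primrec_scaleHash (ha.comp (fst.comp fst)) (ht.comp (fst.comp fst)) (snd.comp fst) snd)
    (primrec_numHash.comp ha) (nat_pow.comp (const 2) (primrec_codeLength.comp hk ha))
    (list_map hl (primrec_strIndex.comp snd).to₂) (primrec_strIndex.comp hv)

/-- The emission `o` if it is bad with respect to the list `l`, for `(((t, k), a), l), o)`. -/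
def badStep (s : (((List ℕ × ℕ) × ℕ) × List Str) × Option Str) : Option Str :=
  s.2.bind fun v => cond (isBadStr s.1.1.1.1 s.1.1.1.2 s.1.1.2 s.1.2 v) (some v) none

open Primrec in
theorem primrec_badStep : Primrec badStep := by
  have hb : Primrec fun s : ((((List ℕ × ℕ) × ℕ) × List Str) × Option Str) × Str =>
      isBadStr s.1.1.1.1.1 s.1.1.1.1.2 s.1.1.1.2 s.1.1.2 s.2 :=
    primrec_isBadStr (fst.comp (fst.comp (fst.comp (fst.comp fst))))
      (snd.comp (fst.comp (fst.comp (fst.comp fst)))) (snd.comp (fst.comp (fst.comp fst)))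
      (snd.comp (fst.comp fst)) snd
  exact option_bind snd (Primrec.cond hb (option_some.comp snd) (const _)).to₂

/-- The enumeration of the strings that are bad when they are emitted. -/
def badEnum (S : ℕ × Str × Str → Option Str) (T : ℕ → List ℕ) (k a : ℕ) (b : Str) (m : ℕ) :
    Option Str :=
  badStep ((((T a, k), a), seen (shortEnum S k a b) m), shortEnum S k a b m)

open Primrec in
theorem computable_badEnum {S : ℕ × Str × Str → Option Str} (hS : Primrec S) {T : ℕ → List ℕ}
    (hT : Computable T) : Computable₂ fun (s : ℕ × Str) (m : ℕ) =>
      badEnum S T s.1.unpair.1 s.1.unpair.2 s.2 m := by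
  have hk : Primrec fun s : (ℕ × Str) × ℕ => s.1.1.unpair.1 :=
    fst.comp (unpair.comp (fst.comp fst))
  have ha : Primrec fun s : (ℕ × Str) × ℕ => s.1.1.unpair.2 :=
    snd.comp (unpair.comp (fst.comp fst))
  have hE : Primrec fun s : (ℕ × Str) × ℕ =>
      shortEnum S s.1.1.unpair.1 s.1.1.unpair.2 s.1.2 s.2 :=
    primrec_shortEnum hS hk ha (snd.comp fst) snd
  have hE₂ : Computable₂ fun (s : ℕ × Str) (m : ℕ) =>
      shortEnum S s.1.unpair.1 s.1.unpair.2 s.2 m := hE.to_comp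
  have hseen : Computable fun s : (ℕ × Str) × ℕ =>
      seen (shortEnum S s.1.1.unpair.1 s.1.1.unpair.2 s.1.2) s.2 := computable_seen hE₂
  exact primrec_badStep.to_comp.comp (((((hT.comp ha.to_comp).pair hk.to_comp).pair
    ha.to_comp).pair hseen).pair hE.to_comp)

theorem encard_bad_suffix_le (H : ℕ → ℕ → ℕ) (D M : ℕ) (l : List Str) :
    {v | ∃ τ, v :: τ <:+ l ∧ isBad H D M (τ.map strIndex) (strIndex v) = true}.encard ≤
      badCount H D M (l.map strIndex) := by
  induction l with
  | nil => simp
  | cons w l ih =>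
    have hsub : {v | ∃ τ, v :: τ <:+ w :: l ∧
        isBad H D M (τ.map strIndex) (strIndex v) = true} ⊆
        {v | ∃ τ, v :: τ <:+ l ∧ isBad H D M (τ.map strIndex) (strIndex v) = true} ∪
          {v | v = w ∧ isBad H D M (l.map strIndex) (strIndex w) = true} := by
      rintro v ⟨τ, hτ, hb⟩
      rcases List.suffix_cons_iff.1 hτ with h | h
      · obtain ⟨rfl, rfl⟩ := List.cons.inj h
        exact Or.inr ⟨rfl, hb⟩
      · exact Or.inl ⟨τ, h, hb⟩
    refine (Set.encard_le_encard hsub).trans ((Set.encard_union_le _ _).trans ?_)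
    rw [List.map_cons, badCount]
    push_cast
    refine add_le_add ih ?_
    split_ifs with h
    · refine (Set.encard_le_encard (t := {w}) fun v hv => hv.1).trans ?_
      simp
    · simp [h]

theorem mem_emitted_badEnum {S : ℕ × Str × Str → Option Str} {T : ℕ → List ℕ} {k a : ℕ}
    {b v : Str} : v ∈ emitted (badEnum S T k a b) ↔ ∃ m, shortEnum S k a b m = some v ∧
      isBadStr (T a) k a (seen (shortEnum S k a b) m) v = true := by
  constructor
  · rintro ⟨m, hm⟩
    obtain ⟨v', hv', h⟩ := Option.bind_eq_some_iff.1 hm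
    cases hb : isBadStr (T a) k a (seen (shortEnum S k a b) m) v' with
    | false => simp [hb] at h
    | true =>
      simp only [hb, cond_true, Option.some.injEq] at h
      subst h
      exact ⟨m, hv', hb⟩
  · rintro ⟨m, hm, hb⟩
    exact ⟨m, by simp [badEnum, badStep, hm, hb]⟩

theorem numHash_pos (a : ℕ) : 0 < numHash a := by
  unfold numHash; positivity

theorem notMem_of_isBadStr {t : List ℕ} {k a : ℕ} {l : List Str} {v : Str}
    (h : isBadStr t k a l v = true) : v ∉ l := by
  intro hv
  have hc : ∀ i, collides (scaleHash a t i) (2 ^ codeLength k a) (l.map strIndex) (strIndex v)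
      = false := fun i => by
    have : strIndex v ∈ l.map strIndex := List.mem_map_of_mem hv
    simp only [collides, this, decide_true, Bool.not_true, Bool.false_and]
  have := numHash_pos a
  simp [isBadStr, isBad, hc] at h
  omega

/-- By some stage all strings have appeared. Each was judged against the suffix then seen, so all
bad strings are counted by `badCount` of one final list, to which goodness of the table at level `k
+ 1` applies. -/
theorem IsOptimal.encard_emitted_badEnum {U : Lang} (hU : IsOptimal U)
    {S : ℕ × Str × Str → Option Str}
    (hS : ∀ p b v : Str, v ∈ U p b ↔ ∃ t, S (t, p, b) = some v) {T : ℕ → List ℕ} {a : ℕ}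
    (hT : IsGoodTable (argBits a) (6 * a) (scaleHash a (T a))) {k : ℕ} (hk : k + 1 ≤ argBits a)
    (b : Str) :
    ∃ B : ℕ, (emitted (badEnum S T k a b)).encard ≤ B ∧ B * 2 ^ (6 * a) ≤ 2 ^ (k + 1) := by
  have hcard : (emitted (shortEnum S k a b)).encard ≤ (2 ^ (k + 1) : ℕ) := by
    refine (Set.encard_le_encard ?_).trans (hU.encard_condC_le k b)
    rw [hU.emitted_shortEnum hS]
    exact fun v hv => hv.1
  have hfin := Set.finite_of_encard_le_coe hcard
  obtain ⟨m₀, hm₀⟩ := exists_subset_seen (E := shortEnum S k a b) hfin.toFinset (by simp)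
  refine ⟨badCount (scaleHash a (T a)) (numHash a) (2 ^ codeLength k a)
    ((seen (shortEnum S k a b) m₀).map strIndex),
    le_trans (Set.encard_le_encard ?_) (encard_bad_suffix_le _ _ _ _), ?_⟩
  · intro v hv
    obtain ⟨m, hm, hb⟩ := mem_emitted_badEnum.1 hv
    have hnot := notMem_of_isBadStr hb
    have hlt : m < m₀ := by
      by_contra hle
      have h₁ := hm₀ v (hfin.mem_toFinset.2 ⟨m, hm⟩)
      exact hnot ((seen_suffix _ (not_lt.1 hle)).subset h₁)
    refine ⟨seen (shortEnum S k a b) m, ?_, hb⟩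
    rw [← seen_succ_of_notMem hm hnot]
    exact seen_suffix _ hlt
  · refine hT (k + 1) (by omega) _ (mem_listsUpTo.2 ⟨?_, ?_⟩)
    · rw [List.length_map]
      exact length_seen_le hcard _
    · intro n hn
      obtain ⟨v, hv, rfl⟩ := List.mem_map.1 hn
      obtain ⟨j, -, hj⟩ := mem_seen.1 hv
      have : v ∈ emitted (shortEnum S k a b) := ⟨j, hj⟩
      rw [hU.emitted_shortEnum hS] at this
      exact (strIndex_lt v).trans_le (Nat.pow_le_pow_right (by norm_num) this.2)

theorem pair_lt_two_pow {m n L : ℕ} (hm : m < 2 ^ L) (hn : n < 2 ^ L) :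
    Nat.pair m n < 2 ^ (2 * L) := by
  refine (Nat.pair_lt_max_add_one_sq m n).trans_le ?_
  rw [mul_comm 2 L, pow_mul]
  exact Nat.pow_le_pow_left (by omega) 2

theorem lt_argBits (a : ℕ) : a < 2 ^ (a + 2) :=
  Nat.lt_two_pow_self.trans (Nat.pow_lt_pow_right (by norm_num) (by omega))

/-- A string is not bad with respect to an optimal bound for its complexity. -/
theorem IsOptimal.exists_not_isBadStr {U : Lang} (hU : IsOptimal U)
    {S : ℕ × Str × Str → Option Str} (hSp : Primrec S)
    (hS : ∀ p b v : Str, v ∈ U p b ↔ ∃ t, S (t, p, b) = some v) {T : ℕ → List ℕ}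
    (hTc : Computable T) (hT : ∀ a, IsGoodTable (argBits a) (6 * a) (scaleHash a (T a))) :
    ∃ c, ∀ (a : ℕ) (b w : Str), c ≤ a → condC U w b + 1 ≤ argBits a → w.length < argBits a →
      ∃ m, shortEnum S (condC U w b) a b m = some w ∧
        w ∉ seen (shortEnum S (condC U w b) a b) m ∧
        isBadStr (T a) (condC U w b) a (seen (shortEnum S (condC U w b) a b) m) w = false := by
  obtain ⟨c, hc⟩ := hU.condC_le_of_mem_emitted (computable_badEnum hSp hTc)
  -- If `w` were bad, its complexity would be at most (k + 1 − 6a) + 4(a + 2) + c. The saving `6 *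
  -- a` beats the price of naming `k` and `a`, so for `a ≥ c + 10` this is less than `k`.
  refine ⟨c + 10, fun a b w ha hk hw => ?_⟩
  set k := condC U w b with hkdef
  have hmem : w ∈ emitted (shortEnum S k a b) := by
    rw [hU.emitted_shortEnum hS]
    exact ⟨hkdef.ge, hw⟩
  obtain ⟨m, hm, hnot, -⟩ := exists_seen_eq_cons hmem
  refine ⟨m, hm, hnot, ?_⟩
  by_contra hb
  have hb := Bool.eq_true_of_not_eq_false hb
  have hbad : w ∈ emitted (badEnum S T k a b) := mem_emitted_badEnum.2 ⟨m, hm, hb⟩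
  obtain ⟨B, hB₁, hB₂⟩ := hU.encard_emitted_badEnum hS (hT a) hk b
  have hB₀ : 0 < B := by
    have h : (1 : ℕ∞) ≤ B := (Set.one_le_encard_iff_nonempty.2 ⟨w, hbad⟩).trans hB₁
    exact_mod_cast h
  -- A bad string exists, so the bound `B` is at least 1; thus `k + 1 - 6 * a` is not truncated.
  have hδ : 6 * a ≤ k + 1 := by
    refine (Nat.pow_le_pow_iff_right (by norm_num : 1 < 2)).1 (le_trans ?_ hB₂)
    exact Nat.le_mul_of_pos_left _ hB₀
  have hB₃ : B ≤ 2 ^ (k + 1 - 6 * a) := by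
    refine Nat.le_of_mul_le_mul_right (hB₂.trans (le_of_eq ?_)) (show 0 < 2 ^ (6 * a) by positivity)
    rw [← pow_add, Nat.sub_add_cancel hδ]
  have hlt : Nat.pair k a < 2 ^ (2 * (a + 2)) :=
    pair_lt_two_pow (by unfold argBits at hk; omega) (lt_argBits a)
  have := hc _ (Nat.pair k a) (k + 1 - 6 * a) b w hlt
    (by simpa only [Nat.unpair_pair] using hbad)
    (by
      simp only [Nat.unpair_pair]
      exact hB₁.trans (by exact_mod_cast hB₃))
  omega

/-! ### Encoding and decoding by hash values -/

/-- The hash value of a string. -/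
def hashStr (t : List ℕ) (a i : ℕ) (w : Str) : ℕ := scaleHash a t i (strIndex w)

open Primrec in
theorem primrec_hashStr {α : Type*} [Primcodable α] {t : α → List ℕ} {a i : α → ℕ} {w : α → Str}
    (ht : Primrec t) (ha : Primrec a) (hi : Primrec i) (hw : Primrec w) :
    Primrec fun s => hashStr (t s) (a s) (i s) (w s) :=
  primrec_scaleHash ha ht hi (primrec_strIndex.comp hw)

/-- A hash function that has no collision at `w` gives a code from which `w` is found. -/
def IsGoodIndex (S : ℕ × Str × Str → Option Str) (t : List ℕ) (k a i : ℕ) (b w : Str) : Prop :=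
  ∃ m, shortEnum S k a b m = some w ∧ ∀ v ∈ seen (shortEnum S k a b) m,
    hashStr t a i v % 2 ^ codeLength k a ≠ hashStr t a i w % 2 ^ codeLength k a

/-- For each condition fewer than a third of the hash functions collide at `w`, so some function
collides for neither. A single index for both conditions is what makes one code a prefix of the
other. -/
theorem exists_isGoodIndex {S : ℕ × Str × Str → Option Str} {t : List ℕ} {a k₁ k₂ m₁ m₂ : ℕ}
    {b₁ b₂ w : Str} (hm₁ : shortEnum S k₁ a b₁ m₁ = some w)
    (hw₁ : w ∉ seen (shortEnum S k₁ a b₁) m₁)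
    (hb₁ : isBadStr t k₁ a (seen (shortEnum S k₁ a b₁) m₁) w = false)
    (hm₂ : shortEnum S k₂ a b₂ m₂ = some w) (hw₂ : w ∉ seen (shortEnum S k₂ a b₂) m₂)
    (hb₂ : isBadStr t k₂ a (seen (shortEnum S k₂ a b₂) m₂) w = false) :
    ∃ i < numHash a, IsGoodIndex S t k₁ a i b₁ w ∧ IsGoodIndex S t k₂ a i b₂ w := by
  set c₁ : ℕ → Bool := fun i => collides (scaleHash a t i) (2 ^ codeLength k₁ a)
    ((seen (shortEnum S k₁ a b₁) m₁).map strIndex) (strIndex w) with hc₁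
  set c₂ : ℕ → Bool := fun i => collides (scaleHash a t i) (2 ^ codeLength k₂ a)
    ((seen (shortEnum S k₂ a b₂) m₂).map strIndex) (strIndex w) with hc₂
  have h₁ : 3 * (List.range (numHash a)).countP c₁ < numHash a :=
    not_le.1 (of_decide_eq_false hb₁)
  have h₂ : 3 * (List.range (numHash a)).countP c₂ < numHash a :=
    not_le.1 (of_decide_eq_false hb₂)
  have hex : ∃ i < numHash a, c₁ i = false ∧ c₂ i = false := by
    by_contra hne
    push Not at hne
    have hle : (List.range (numHash a)).countP (fun i => c₁ i || c₂ i) = numHash a := by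
      rw [List.countP_eq_length.2, List.length_range]
      intro i hi
      have := hne i (List.mem_range.1 hi)
      cases h : c₁ i <;> simp_all
    have hadd : ∀ l : List ℕ, l.countP (fun i => c₁ i || c₂ i) ≤ l.countP c₁ + l.countP c₂ := by
      intro l
      induction l with
      | nil => simp
      | cons i l ih =>
        simp only [List.countP_cons]
        cases c₁ i <;> cases c₂ i <;> simp <;> omega
    have := hadd (List.range (numHash a))
    omega
  obtain ⟨i, hi, e₁, e₂⟩ := hex
  have key : ∀ {l : List Str} {M : ℕ}, w ∉ l →
      collides (scaleHash a t i) M (l.map strIndex) (strIndex w) = false →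
      ∀ v ∈ l, hashStr t a i v % M ≠ hashStr t a i w % M := by
    intro l M hwl hcol v hv heq
    have hnot : strIndex w ∉ l.map strIndex := fun h => by
      obtain ⟨u, hu, e⟩ := List.mem_map.1 h
      exact hwl (strIndex_injective e ▸ hu)
    have : collides (scaleHash a t i) M (l.map strIndex) (strIndex w) = true := by
      simp only [collides, hnot, decide_false, Bool.not_false, Bool.true_and, List.any_eq_true,
        decide_eq_true_eq]
      exact ⟨strIndex v, List.mem_map_of_mem hv, heq⟩
    rw [this] at hcol
    exact absurd hcol (by simp)
  exact ⟨i, hi, ⟨m₁, hm₁, key hw₁ e₁⟩, ⟨m₂, hm₂, key hw₂ e₂⟩⟩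

/-- The emission `o` if its hash value has the digits `p`, for `(((t, a), i), p), o)`. -/
def matchStep (s : (((List ℕ × ℕ) × ℕ) × Str) × Option Str) : Option Str :=
  s.2.bind fun v => if hashStr s.1.1.1.1 s.1.1.1.2 s.1.1.2 v % 2 ^ s.1.2.length = ofBits s.1.2
    then some v else none

open Primrec in
theorem primrec_matchStep : Primrec matchStep := by
  have hh : Primrec fun s : ((((List ℕ × ℕ) × ℕ) × Str) × Option Str) × Str =>
      hashStr s.1.1.1.1.1 s.1.1.1.1.2 s.1.1.1.2 s.2 :=
    primrec_hashStr (fst.comp (fst.comp (fst.comp (fst.comp fst))))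
      (snd.comp (fst.comp (fst.comp (fst.comp fst)))) (snd.comp (fst.comp (fst.comp fst))) snd
  have hp : Primrec fun s : ((((List ℕ × ℕ) × ℕ) × Str) × Option Str) × Str => s.1.1.2 :=
    snd.comp (fst.comp fst)
  have hM : Primrec fun s : ((((List ℕ × ℕ) × ℕ) × Str) × Option Str) × Str =>
      2 ^ s.1.1.2.length := nat_pow.comp (const 2) (list_length.comp hp)
  exact option_bind snd (Primrec.ite (Primrec.eq.comp (nat_mod.comp hh hM)
    (primrec_ofBits.comp hp)) (option_some.comp snd) (const _)).to₂

/-- Strings emitted before `w` have other digits, so the first match is `w`; later collisions do not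
matter. -/
theorem mem_rfindOpt_matchStep {S : ℕ × Str × Str → Option Str} {t : List ℕ} {k a i : ℕ}
    {b w : Str} (h : IsGoodIndex S t k a i b w) :
    w ∈ Nat.rfindOpt fun m => matchStep ((((t, a), i),
      toBits (codeLength k a) (hashStr t a i w)), shortEnum S k a b m) := by
  obtain ⟨m, hm, hcol⟩ := h
  set f : ℕ → Option Str := fun m => matchStep ((((t, a), i),
      toBits (codeLength k a) (hashStr t a i w)), shortEnum S k a b m) with hf
  have hfm : f m = some w := by
    simp [hf, matchStep, hm, ofBits_toBits]
  have hf' : ∀ m' v, f m' = some v → shortEnum S k a b m' = some v ∧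
      hashStr t a i v % 2 ^ codeLength k a = hashStr t a i w % 2 ^ codeLength k a := by
    intro m' v hv
    obtain ⟨v', hv', h'⟩ := Option.bind_eq_some_iff.1 hv
    split_ifs at h' with he
    obtain rfl := Option.some.inj h'
    simp only [length_toBits, ofBits_toBits] at he
    exact ⟨hv', he⟩
  classical
  have hex : ∃ m, (f m).isSome := ⟨m, by rw [hfm]; rfl⟩
  have hval : f (Nat.find hex) = some w := by
    obtain ⟨v, hv⟩ := Option.isSome_iff_exists.1 (Nat.find_spec hex)
    obtain ⟨h₁, h₂⟩ := hf' _ _ hv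
    rcases (Nat.find_min' hex (by rw [hfm]; rfl : (f m).isSome)).lt_or_eq with hlt | heq
    · exact absurd h₂ (hcol v (mem_seen.2 ⟨_, hlt, h₁⟩))
    · rw [heq, hfm]
  have hdom : (Nat.rfindOpt f).Dom := Nat.rfindOpt_dom.2 ⟨m, w, hfm⟩
  have hrf : Nat.find hex ∈ Nat.rfind (fun n => Part.some (f n).isSome : ℕ →. Bool) :=
    Nat.mem_rfind.2 ⟨Part.mem_some_iff.2 (Nat.find_spec hex).symm, fun hlt =>
      Part.mem_some_iff.2 (by simpa using Nat.find_min hex hlt)⟩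
  exact Part.mem_bind hrf (by rw [hval]; exact Part.mem_some w)

theorem IsOptimal.condC_decode_le {U : Lang} (hU : IsOptimal U)
    {S : ℕ × Str × Str → Option Str} (hS : Primrec S) {T : ℕ → List ℕ} (hT : Computable T) :
    ∃ c, ∀ (L k a i : ℕ) (b w : Str), k < 2 ^ L → a < 2 ^ L → i < 2 ^ L →
      IsGoodIndex S (T a) k a i b w →
      condC U w (pair (toBits (codeLength k a) (hashStr (T a) a i w)) b) ≤ 8 * L + c := by
  open Primrec in
  have hk : Primrec fun s : (ℕ × Str × Str) × ℕ => s.1.1.unpair.1.unpair.1 :=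
    fst.comp (unpair.comp (fst.comp (unpair.comp (fst.comp fst))))
  open Primrec in
  have hi : Primrec fun s : (ℕ × Str × Str) × ℕ => s.1.1.unpair.1.unpair.2 :=
    snd.comp (unpair.comp (fst.comp (unpair.comp (fst.comp fst))))
  open Primrec in
  have ha : Primrec fun s : (ℕ × Str × Str) × ℕ => s.1.1.unpair.2 :=
    snd.comp (unpair.comp (fst.comp fst))
  open Primrec in
  have hp : Primrec fun s : (ℕ × Str × Str) × ℕ => unpairFst s.1.2.2 :=
    primrec_unpairFst.comp (snd.comp (snd.comp fst))
  open Primrec in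
  have hb : Primrec fun s : (ℕ × Str × Str) × ℕ => unpairSnd s.1.2.2 :=
    primrec_unpairSnd.comp (snd.comp (snd.comp fst))
  have hE := primrec_shortEnum hS hk ha hb Primrec.snd
  have hg : Computable₂ fun (s : ℕ × Str × Str) (m : ℕ) =>
      matchStep ((((T s.1.unpair.2, s.1.unpair.2), s.1.unpair.1.unpair.2), unpairFst s.2.2),
        shortEnum S s.1.unpair.1.unpair.1 s.1.unpair.2 (unpairSnd s.2.2) m) :=
    primrec_matchStep.to_comp.comp (((((hT.comp ha.to_comp).pair ha.to_comp).pair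
      hi.to_comp).pair hp.to_comp).pair hE.to_comp)
  obtain ⟨c, hc⟩ := hU.condC_le_of_partrec (Partrec.rfindOpt hg)
  refine ⟨c, fun L k a i b w hkL haL hiL h => ?_⟩
  -- The three parameters need `4 * L` digits, written at double cost. The hash digits themselves
  -- are part of the condition and are free.
  have hlt : Nat.pair (Nat.pair k i) a < 2 ^ (2 * (2 * L)) :=
    pair_lt_two_pow (pair_lt_two_pow hkL hiL)
      (haL.trans_le (Nat.pow_le_pow_right (by norm_num) (by omega)))
  have := hc _ _ [] (pair (toBits (codeLength k a) (hashStr (T a) a i w)) b) w hlt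
    (by
      simp only [Nat.unpair_pair, unpairFst_pair, unpairSnd_pair]
      exact mem_rfindOpt_matchStep h)
  simp only [List.length_nil] at this
  omega

/-- The first `l` digits of the hash value of `w`, for `(((t, a), l), i, w)`. -/
def encodeStep (s : ((List ℕ × ℕ) × ℕ) × ℕ × Str) : Str :=
  toBits s.1.2 (hashStr s.1.1.1 s.1.1.2 s.2.1 s.2.2)

open Primrec in
theorem primrec_encodeStep : Primrec encodeStep :=
  primrec_toBits.comp (snd.comp fst) (primrec_hashStr (fst.comp (fst.comp fst))
    (snd.comp (fst.comp fst)) (fst.comp snd) (snd.comp snd))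

theorem IsOptimal.condC_encode_le {U : Lang} (hU : IsOptimal U) {T : ℕ → List ℕ}
    (hT : Computable T) :
    ∃ c, ∀ (L l a i : ℕ) (w : Str), l < 2 ^ L → a < 2 ^ L → i < 2 ^ L →
      condC U (toBits l (hashStr (T a) a i w)) w ≤ 8 * L + c := by
  open Primrec in
  have hl : Primrec fun s : ℕ × Str × Str => s.1.unpair.1.unpair.1 :=
    fst.comp (unpair.comp (fst.comp (unpair.comp fst)))
  open Primrec in
  have hi : Primrec fun s : ℕ × Str × Str => s.1.unpair.1.unpair.2 :=
    snd.comp (unpair.comp (fst.comp (unpair.comp fst)))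
  open Primrec in
  have ha : Primrec fun s : ℕ × Str × Str => s.1.unpair.2 := snd.comp (unpair.comp fst)
  open Primrec in
  have hw : Primrec fun s : ℕ × Str × Str => s.2.2 := snd.comp snd
  have hF : Computable fun s : ℕ × Str × Str => encodeStep (((T s.1.unpair.2, s.1.unpair.2),
      s.1.unpair.1.unpair.1), s.1.unpair.1.unpair.2, s.2.2) :=
    primrec_encodeStep.to_comp.comp ((((hT.comp ha.to_comp).pair ha.to_comp).pair hl.to_comp).pair
      (hi.to_comp.pair hw.to_comp))
  obtain ⟨c, hc⟩ := hU.condC_le_of_partrec hF.partrec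
  refine ⟨c, fun L l a i w hlL haL hiL => ?_⟩
  have hlt : Nat.pair (Nat.pair l i) a < 2 ^ (2 * (2 * L)) :=
    pair_lt_two_pow (pair_lt_two_pow hlL hiL)
      (haL.trans_le (Nat.pow_le_pow_right (by norm_num) (by omega)))
  have := hc _ _ [] w (toBits l (hashStr (T a) a i w)) hlt
    (Part.mem_some_iff.2 (by simp only [Nat.unpair_pair, encodeStep]))
  simp only [List.length_nil] at this
  omega

/-- Both components are prefixes of the longer one, so only that one and the two lengths have to be
described. -/
theorem IsOptimal.plainC_pair_toBits_le {U : Lang} (hU : IsOptimal U) :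
    ∃ c, ∀ (L l₁ l₂ h : ℕ), l₁ < 2 ^ L → l₂ < 2 ^ L →
      plainC U (pair (toBits l₁ h) (toBits l₂ h)) ≤ max l₁ l₂ + 4 * L + c := by
  open Primrec in
  have hF : Primrec fun s : ℕ × Str × Str =>
      pair (s.2.1.take s.1.unpair.1) (s.2.1.take s.1.unpair.2) :=
    primrec_pair.comp (list_take.comp (fst.comp (unpair.comp fst)) (fst.comp snd))
      (list_take.comp (snd.comp (unpair.comp fst)) (fst.comp snd))
  obtain ⟨c, hc⟩ := hU.condC_le_of_partrec hF.to_comp.partrec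
  refine ⟨c, fun L l₁ l₂ h h₁ h₂ => ?_⟩
  have := hc _ _ (toBits (max l₁ l₂) h) [] (pair (toBits l₁ h) (toBits l₂ h))
    (pair_lt_two_pow h₁ h₂)
    (by simp [take_toBits])
  rw [length_toBits] at this
  unfold plainC
  omega

/-- Every string `w` has, for two conditions, codes of lengths close to its conditional
complexities such that the shorter code is a prefix of the longer one. -/
theorem IsOptimal.exists_codes {U : Lang} (hU : IsOptimal U) :
    ∃ c, ∀ (a : ℕ) (x y w : Str), c ≤ a → condC U w x + 1 ≤ argBits a →
      condC U w y + 1 ≤ argBits a → w.length < argBits a →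
      ∃ p q : Str, p.length = codeLength (condC U w x) a ∧ q.length = codeLength (condC U w y) a ∧
        condC U p w ≤ 100 * a + c ∧ condC U q w ≤ 100 * a + c ∧
        condC U w (pair p x) ≤ 100 * a + c ∧ condC U w (pair q y) ≤ 100 * a + c ∧
        plainC U (pair p q) ≤ max (condC U w x) (condC U w y) + 100 * a + c := by
  obtain ⟨S, hS, hSU⟩ := exists_primrec_stage hU.1
  obtain ⟨T, hTc, hT⟩ := exists_computable_table
  obtain ⟨c₁, h₁⟩ := hU.exists_not_isBadStr hS hSU hTc hT
  obtain ⟨c₂, h₂⟩ := hU.condC_decode_le hS hTc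
  obtain ⟨c₃, h₃⟩ := hU.condC_encode_le hTc
  obtain ⟨c₄, h₄⟩ := hU.plainC_pair_toBits_le
  refine ⟨c₁ + c₂ + c₃ + c₄ + 200, fun a x y w ha hkx hky hw => ?_⟩
  obtain ⟨m₁, e₁, n₁, b₁⟩ := h₁ a x w (by omega) hkx hw
  obtain ⟨m₂, e₂, n₂, b₂⟩ := h₁ a y w (by omega) hky hw
  obtain ⟨i, hi, g₁, g₂⟩ := exists_isGoodIndex e₁ n₁ b₁ e₂ n₂ b₂
  -- Large enough for the index, as `numHash a ≤ 2 ^ (7 * a + 3)`, and for the code lengths, which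
  -- are below `2 ^ (a + 6)`.
  set L := 7 * a + 10 with hL
  have hpow : ∀ j ≤ L, 2 ^ j ≤ 2 ^ L := fun j hj => Nat.pow_le_pow_right (by norm_num) hj
  have haL : a < 2 ^ L := (lt_argBits a).trans_le (hpow _ (by omega))
  have hiL : i < 2 ^ L := by
    refine hi.trans_le (le_trans ?_ (hpow (6 * a + (a + 3)) (by omega)))
    unfold numHash argBits
    rw [pow_add 2 (6 * a)]
    refine Nat.mul_le_mul_left _ ?_
    have := Nat.one_le_two_pow (n := a + 2)
    have e : 2 ^ (a + 3) = 2 ^ (a + 2) * 2 := pow_succ 2 (a + 2)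
    rw [e]
    linarith
  have hargL : argBits a ≤ 2 ^ L := hpow _ (by omega)
  have hlenL : ∀ k, k + 1 ≤ argBits a → codeLength k a < 2 ^ L := by
    intro k hk
    have h8 : codeLength k a < 2 ^ (a + 6) := by
      have := lt_argBits a
      unfold codeLength
      unfold argBits at hk
      have e : 2 ^ (a + 6) = 2 ^ (a + 2) * 16 := by rw [show a + 6 = a + 2 + 4 by ring, pow_add]; norm_num
      omega
    exact h8.trans_le (hpow _ (by omega))
  refine ⟨toBits (codeLength (condC U w x) a) (hashStr (T a) a i w),
    toBits (codeLength (condC U w y) a) (hashStr (T a) a i w), length_toBits _ _,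
    length_toBits _ _, ?_, ?_, ?_, ?_, ?_⟩
  · have := h₃ L _ a i w (hlenL _ hkx) haL hiL
    omega
  · have := h₃ L _ a i w (hlenL _ hky) haL hiL
    omega
  · have := h₂ L _ a i x w (by omega) haL hiL g₁
    omega
  · have := h₂ L _ a i y w (by omega) haL hiL g₂
    omega
  · have := h₄ L _ _ (hashStr (T a) a i w) (hlenL _ hkx) (hlenL _ hky)
    unfold codeLength at this ⊢
    omega

end InfoNet

/-! ### The upper bound -/

namespace InfoNet

/-- The codes of `pair y z` for the conditions `x` and `y` serve as `p` and `q`. In the last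
inequality, symmetry of information is combined with C(y,z|x) ≤ C(p,q|x) (decoding from `p` and `x`)
and C(y,z|y) ≤ C(z|y). -/
theorem IsOptimal.exists_transmission {U : Lang} (hU : IsOptimal U) :
    ∃ c, ∀ (a n : ℕ) (x y z : Str), c ≤ a → 3 * n + c ≤ 2 ^ a →
      x.length ≤ n → y.length ≤ n → z.length ≤ n →
      ∃ p q : Str, p.length ≤ 3 * n + 6 * a + c ∧ q.length ≤ 3 * n + 6 * a + c ∧
        condC U p (pair x (pair y z)) ≤ 100 * a + c ∧
        condC U q (pair x (pair y z)) ≤ 100 * a + c ∧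
        condC U y (pair p x) ≤ 100 * a + c ∧ condC U z (pair q y) ≤ 100 * a + c ∧
        plainC U x + condC U (pair y z) x ≤ condC U x (pair p q) +
          max (condC U (pair y z) x) (condC U z y) + 400 * a + c := by
  obtain ⟨c₁, h₁⟩ := hU.exists_codes
  obtain ⟨c₂, h₂⟩ := hU.condC_le_length
  obtain ⟨c₃, h₃⟩ := hU.symmetry_of_information
  obtain ⟨c₄, h₄⟩ := hU.condC_map_le (f := fun s => s.1) Primrec.fst primrec_unpairSnd
  obtain ⟨c₅, h₅⟩ := hU.condC_map_le (f := fun s => unpairFst s.1) (e := id)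
    (primrec_unpairFst.comp Primrec.fst) Primrec.id
  obtain ⟨c₆, h₆⟩ := hU.condC_map_le (f := fun s => unpairSnd s.1) (e := id)
    (primrec_unpairSnd.comp Primrec.fst) Primrec.id
  obtain ⟨c₇, h₇⟩ := hU.condC_map_le (f := fun s => pair s.2 s.1) (e := id)
    (primrec_pair.comp Primrec.snd Primrec.fst) Primrec.id
  obtain ⟨c₈, h₈⟩ := hU.condC_bind_le (g := fun s => pair (unpairFst s.2) s.1)
    (h := fun s => s.2.2)
    (primrec_pair.comp (primrec_unpairFst.comp Primrec.snd) Primrec.fst)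
    (Primrec.snd.comp Primrec.snd)
  refine ⟨3 * c₁ + c₂ + c₃ + c₄ + c₅ + c₆ + c₇ + c₈ + 100, fun a n x y z ha hn hx hy hz => ?_⟩
  have hw : (pair y z).length ≤ 3 * n + 1 := by rw [length_pair]; omega
  have harg : argBits a = 2 ^ a * 4 := by rw [argBits, pow_add]; norm_num
  have haa : a < 2 ^ a := Nat.lt_two_pow_self
  have hkx := h₂ (pair y z) x
  have hky := h₂ (pair y z) y
  obtain ⟨p, q, hp, hq, hpw, hqw, hwp, hwq, hpq⟩ := h₁ a x y (pair y z) (by omega)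
    (by omega) (by omega) (by omega)
  unfold codeLength at hp hq
  have e₃ := h₃ (a + 10) x (pair p q) (by
    rw [length_pair, pow_add]
    omega)
  have e₄p := h₄ p (pair x (pair y z))
  have e₄q := h₄ q (pair x (pair y z))
  have e₅ := h₅ (pair y z) (pair p x)
  have e₆ := h₆ (pair y z) (pair q y)
  have e₇ := h₇ z y
  have e₈ := h₈ x (pair p q) (pair y z)
  simp only [unpairFst_pair, unpairSnd_pair, id] at e₄p e₄q e₅ e₆ e₇ e₈
  exact ⟨p, q, by omega, by omega, by omega, by omega, by omega, by omega, by omega⟩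

theorem privateDisclosure_isLogUpperBound :
    IsLogUpperBound privateDisclosure (fun (U : Lang) (x y z : Str) =>
      max 0 ((condC U z y : ℤ) - (condC U (pair y z) x : ℤ))) := by
  intro U hU
  obtain ⟨c, hc⟩ := hU.exists_transmission
  obtain ⟨B, hB, hlog⟩ := exists_log_bound (3 + c)
  -- Since the logarithm is at least 1, it absorbs the additive constants; the final `+ 1` gives the
  -- strict inequalities that a transmission requires.
  refine ⟨400 * (1 + B + c) + c + 1, fun n x y z hx hy hz => ?_⟩
  obtain ⟨L, hL, hLn⟩ := hlog n
  have hpow : 2 ^ L ≤ 2 ^ (L + c) := Nat.pow_le_pow_right (by norm_num) (by omega)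
  obtain ⟨p, q, hp, hq, h₁, h₂, h₃, h₄, h₅⟩ := hc (L + c) n x y z (by omega)
    (by nlinarith) hx hy hz
  have hn0 : (0 : ℝ) ≤ n := Nat.cast_nonneg n
  have hc0 : (0 : ℝ) ≤ c := Nat.cast_nonneg c
  set l := Real.logb 2 ((n : ℝ) + 2) with hl
  have hl1 : 1 ≤ l := by
    rw [hl, Real.le_logb_iff_rpow_le (by norm_num) (by linarith), Real.rpow_one]
    linarith
  have hln : l ≤ n + 1 := by
    rw [hl, Real.logb_le_iff_le_rpow (by norm_num) (by linarith)]
    have h : n + 2 ≤ 2 ^ (n + 1) := Nat.lt_two_pow_self (n := n + 1)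
    exact_mod_cast h
  have ha : ((L + c : ℕ) : ℝ) ≤ l + B + c := by push_cast; linarith
  have hBl : B ≤ B * l := le_mul_of_one_le_right hB hl1
  have hcl : (c : ℝ) ≤ c * l := le_mul_of_one_le_right hc0 hl1
  have hmain : 400 * (l + B + c) + c < (400 * (1 + B + c) + c + 1) * l := by linarith
  have hlen : ∀ s : Str, s.length ≤ 3 * n + 6 * (L + c) + c →
      (s.length : ℝ) ≤ (400 * (1 + B + c) + c + 1) * ((n : ℝ) + 1) := by
    intro s hs
    have hs : (s.length : ℝ) ≤ 3 * n + 6 * ((L + c : ℕ) : ℝ) + c := by exact_mod_cast hs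
    have hBn : 0 ≤ B * n := mul_nonneg hB hn0
    have hcn : 0 ≤ (c : ℝ) * n := mul_nonneg hc0 hn0
    linarith
  have hlt : ∀ k : ℕ, k ≤ 100 * (L + c) + c → (k : ℝ) < (400 * (1 + B + c) + c + 1) * l := by
    intro k hk
    have hk : (k : ℝ) ≤ 100 * ((L + c : ℕ) : ℝ) + c := by exact_mod_cast hk
    have : (0 : ℝ) ≤ (L + c : ℕ) := Nat.cast_nonneg _
    linarith
  refine ⟨p, q, hlen p hp, hlen q hq, ⟨hlt _ h₁, hlt _ h₂, hlt _ h₃, hlt _ h₄⟩, ?_⟩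
  have r : (plainC U x : ℝ) + condC U (pair y z) x ≤ condC U x (pair p q) +
      max (condC U (pair y z) x : ℝ) (condC U z y) + 400 * ((L + c : ℕ) : ℝ) + c := by
    exact_mod_cast h₅
  have hmax : max (condC U (pair y z) x : ℝ) (condC U z y) - condC U (pair y z) x =
      max 0 ((condC U z y : ℝ) - condC U (pair y z) x) := by
    rw [← max_sub_sub_right, sub_self]
  unfold privateDisclosure info
  push_cast
  linarith

end InfoNet

theorem theorem4 :
    InfoNet.IsMinimalValue InfoNet.privateDisclosure
      (fun (U : InfoNet.Lang) (x y z : InfoNet.Str) =>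
        max 0 ((InfoNet.condC U z y : ℤ) - (InfoNet.condC U (InfoNet.pair y z) x : ℤ))) :=
  ⟨InfoNet.privateDisclosure_isLowerBound, InfoNet.privateDisclosure_isLogUpperBound⟩
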